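/- Let $n\ge 1$ and let $A$ be an $n\times n$ complex matrix. Call a matrix $B$ a partial isometry if $\|Bx\|=\|x\|$ for all $x\in(\ker B)^\perp$ (Euclidean norm on $\mathbb{C}^n$). Let $a(A)$ be the ascent of $A$, the least $k\ge 0$ with $\ker A^k=\ker A^{k+1}$; let $p(A)=\sup\{k\ge 0 : I,A,A^2,\dots,A^k \text{ are all partial isometries}\}\in\{0,1,2,\dots\}\cup\{\infty\}$; and let $W(A)=\{\langle Ax,x\rangle : x\in\mathbb{C}^n,\ \|x\|=1\}$ be the numerical range of $A$. For $k\ge 1$ let $J_k$ be the nilpotent $k\times k$ Jordan block, with ones on the superdiagonal and zeros elsewhere. Say that $A$ has no unitary part if it is not unitarily similar to a matrix of the form $U\oplus B$ with $U$ unitary of size at least $1$ (here $B$ may have size $0$). Suppose that $p(A)\ge a(A)-1$. Then the following conditions are equivalent: (a) $W(A)$ is a closed circular disc centered at the origin, of some radius $r\ge 0$ (the one-point disc $\{0\}$ is allowed); (b) $A$ is unitarily similar to a direct sum $J_{k_1}\oplus\cdots\oplus J_{k_s}$ with $s\ge 1$ and all $k_i\ge 1$; (c) $A$ has no unitary part and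 $A^j$ is a partial isometry for all $j\ge 1$; (d) $A$ has no unitary part and $A,A^2,\dots,A^\ell$ are partial isometries for some integer $\ell>a(A)$. In this case, $W(A)=\{z\in\mathbb{C} : |z|\le\cos(\pi/(a(A)+1))\}$ and $p(A)=\infty$. -/

import Mathlib

open scoped Matrix

namespace PowerPartialIsometry

/-- `A` is a partial isometry: `‖A x‖ = ‖x‖` for all `x` in the orthogonal complement of `ker A`,
in `ℂⁿ` with its Euclidean norm. -/
def IsPartialIsometry {n : ℕ} (A : Matrix (Fin n) (Fin n) ℂ) : Prop :=
  ∀ x ∈ (LinearMap.ker (Matrix.toEuclideanLin A))ᗮ, ‖Matrix.toEuclideanLin A x‖ = ‖x‖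

/-- The ascent `a(A)`: the least `k ≥ 0` with `ker A ^ k = ker A ^ (k + 1)`.
(Such a `k` always exists, because the dimension is finite.) -/
noncomputable def ascent {n : ℕ} (A : Matrix (Fin n) (Fin n) ℂ) : ℕ :=
  sInf {k : ℕ | LinearMap.ker (Matrix.toEuclideanLin (A ^ k)) =
    LinearMap.ker (Matrix.toEuclideanLin (A ^ (k + 1)))}

/-- The power partial isometry index
`p(A) = sup {k ≥ 0 : I, A, A ^ 2, …, A ^ k are all partial isometries}`, possibly `∞`. -/
noncomputable def powerIndex {n : ℕ} (A : Matrix (Fin n) (Fin n) ℂ) : ℕ∞ :=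
  ⨆ k ∈ {k : ℕ | ∀ j ≤ k, IsPartialIsometry (A ^ j)}, (k : ℕ∞)

/-- The numerical range `W(A) = {⟨A x, x⟩ : x ∈ ℂⁿ, ‖x‖ = 1}`. Mathlib's inner product is
linear in its second argument, so `⟨A x, x⟩` is written `inner ℂ x (A x)`. -/
def numericalRange {n : ℕ} (A : Matrix (Fin n) (Fin n) ℂ) : Set ℂ :=
  {z | ∃ x : EuclideanSpace ℂ (Fin n), ‖x‖ = 1 ∧ inner ℂ x (Matrix.toEuclideanLin A x) = z}

/-- `S` is a closed circular disc centered at the origin (the one-point disc `{0}` is allowed). -/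
def IsDiscAtZero (S : Set ℂ) : Prop :=
  ∃ r : ℝ, 0 ≤ r ∧ S = Metric.closedBall 0 r

/-- Unitary similarity `B = Uᴴ A U` of square matrices, which may be indexed by two different
finite types; a unitary `U` then has its rows indexed by the one and its columns by the other. -/
def UnitarilySimilar {m n : Type*} [Fintype m] [DecidableEq m] [Fintype n] [DecidableEq n]
    (A : Matrix m m ℂ) (B : Matrix n n ℂ) : Prop :=
  ∃ U : Matrix m n ℂ, Uᴴ * U = 1 ∧ U * Uᴴ = 1 ∧ B = Uᴴ * A * U

/-- The nilpotent Jordan block `J_k`, with ones on the superdiagonal and zeros elsewhere. -/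
def jordanBlock (k : ℕ) : Matrix (Fin k) (Fin k) ℂ :=
  Matrix.of fun i j => if (i : ℕ) + 1 = (j : ℕ) then 1 else 0

/-- `A` is unitarily similar to a direct sum of (nilpotent) Jordan blocks of sizes at least `1`. -/
def IsSumOfJordanBlocks {n : ℕ} (A : Matrix (Fin n) (Fin n) ℂ) : Prop :=
  ∃ (s : ℕ) (k : Fin s → ℕ), (∀ i, 1 ≤ k i) ∧
    UnitarilySimilar A (Matrix.blockDiagonal' fun i => jordanBlock (k i))

/-- `A` has no unitary part: it is not unitarily similar to a matrix `U ⊕ B` with `U` unitary of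
size at least `1`. (`B` may have size `0`, so a unitary `A` does have a unitary part.) -/
def HasNoUnitaryPart {n : ℕ} (A : Matrix (Fin n) (Fin n) ℂ) : Prop :=
  ¬ ∃ (p q : ℕ) (U : Matrix (Fin p) (Fin p) ℂ) (B : Matrix (Fin q) (Fin q) ℂ),
    1 ≤ p ∧ U ∈ Matrix.unitaryGroup (Fin p) ℂ ∧ UnitarilySimilar A (Matrix.fromBlocks U 0 0 B)

end PowerPartialIsometry

namespace PowerPartialIsometry

/-! Write `T` for the operator of `A` and `a` for its ascent. The heart of the matter is that (a),
and likewise (d), forces `T ^ a = 0`; then all higher powers vanish and every power is a partial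
isometry.

If `S`, `R` and `S R` are partial isometries, the initial projection of `S` commutes with the final
projection of `R`. Hence `T ^ i` sends the complement of `ker T ^ (i + j)` into that of `ker T ^ j`,
and suitable vectors generate orthogonal chains `x, T x, T² x, …` of constant norm, that is, Jordan
blocks.

Under (a), let `r` be the radius. Each rotation of `A` has `r` as top eigenvalue of its real part,
so the determinant of `2 r X - X² A⋆ - A` vanishes on the unit circle, hence identically. A
polynomial kernel vector gives a three-term recurrence, solved by `T ^ k x_k = U_k(r) x_0` with the
Chebyshev polynomials `U_k`. If `r` exceeded `cos (π / (a + 1))`, then `U_a(r)` would be positive,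
contradicting the definition of ascent (`le_cos_of_recurrence`). A discrete sine vector on a chain
of length `a` gives the reverse inequality. If `T ^ a` were nonzero, a chain with a nonzero diagonal
entry at its start would push the Rayleigh quotient above this bound
(`pow_eq_zero_of_numericalRadius_le`).

Under (d), `T` preserves the complement of `ker T ^ a`, so `T ^ a ≠ 0` would produce a unimodular
reducing eigenvector, i.e. a unitary part. A nilpotent `T` with all powers partial isometries splits
into orthogonal chains, which is (b); diagonal unitaries rotate a sum of Jordan blocks, which gives
(a). -/

/-- In a C⋆-ring, if `s`, `t` and `s * t` are partial isometries (in the algebraic sense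
`x x⋆ x = x`), then the initial projection of `s` and the final projection of `t` commute. -/
theorem commute_projections_of_mul {R : Type*} [NonUnitalNormedRing R] [StarRing R] [CStarRing R]
    {s t : R} (hs : s * star s * s = s) (ht : t * star t * t = t)
    (hst : s * t * star (s * t) * (s * t) = s * t) :
    Commute (star s * s) (t * star t) := by
  have hE : star s * s * (star s * s) = star s * s := by
    rw [mul_assoc, ← mul_assoc s, hs]
  have hF : t * star t * (t * star t) = t * star t := by
    rw [← mul_assoc, ht]
  have hEF : star s * s * (t * star t) * (star s * s) * (t * star t)
      = star s * s * (t * star t) := by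
    have := congrArg (fun x => star s * x * star t) hst
    simpa only [star_mul, mul_assoc] using this
  have hEs : star (star s * s) = star s * s := by simp
  have hFs : star (t * star t) = t * star t := by simp
  generalize star s * s = e at *
  generalize t * star t = f at *
  -- Since `e f e f = e f`, this product vanishes; the C⋆-identity then gives `e f = e f e`, which
  -- is self-adjoint.
  have h0 : (e * f - e * f * e) * star (e * f - e * f * e) = 0 := by
    simp only [star_sub, star_mul, hEs, hFs]
    have h1 : (e * f - e * f * e) * (f * e - e * (f * e))
        = e * (f * f) * e - e * f * e * f * e - (e * f * e * f * e - e * f * (e * e) * f * e) := by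
      noncomm_ring
    rw [h1, hF, hE, hEF]
    simp
  rw [CStarRing.mul_star_self_eq_zero_iff, sub_eq_zero] at h0
  have h1 := congrArg star h0
  simp only [star_mul, hEs, hFs] at h1
  rw [commute_iff_eq, h0, h1, mul_assoc]

/-! ### Partial isometries on a Hilbert space and their powers. -/

section Operator

variable {E : Type*} [NormedAddCommGroup E] [InnerProductSpace ℂ E] [CompleteSpace E]

/-- An operator is a partial isometry in the algebraic sense `T T⋆ T = T`. -/
def IsPartialIsom (T : E →L[ℂ] E) : Prop :=
  T * star T * T = T

theorem inner_star_left (T : E →L[ℂ] E) (x y : E) : inner ℂ ((star T) x) y = inner ℂ x (T y) :=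
  ContinuousLinearMap.adjoint_inner_left T y x

theorem inner_star_right (T : E →L[ℂ] E) (x y : E) : inner ℂ x ((star T) y) = inner ℂ (T x) y :=
  ContinuousLinearMap.adjoint_inner_right T x y

theorem isPartialIsom_of_norm_eq {T : E →L[ℂ] E}
    (h : ∀ x ∈ (LinearMap.ker (T : E →ₗ[ℂ] E))ᗮ, ‖T x‖ = ‖x‖) : IsPartialIsom T := by
  set K := LinearMap.ker (T : E →ₗ[ℂ] E) with hK
  have hKc : IsClosed (K : Set E) := T.isClosed_ker
  have : CompleteSpace K := hKc.completeSpace_coe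
  let S : Kᗮ →ₗᵢ[ℂ] E := ⟨(T : E →ₗ[ℂ] E).comp Kᗮ.subtype, fun x => h x x.2⟩
  have hinner : ∀ x ∈ Kᗮ, ∀ y ∈ Kᗮ, inner ℂ (T x) (T y) = inner ℂ x y := fun x hx y hy =>
    S.inner_map_map ⟨x, hx⟩ ⟨y, hy⟩
  have hmem : ∀ y, (star T) y ∈ Kᗮ := fun y => by
    rw [Submodule.mem_orthogonal]
    intro u hu
    have hu' : T u = 0 := hu
    rw [inner_star_right, hu', inner_zero_left]
  -- By polarization `T⋆ T x - x` is orthogonal to all of `Kᗮ`, in which it lies.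
  have hfix : ∀ x ∈ Kᗮ, (star T) (T x) = x := fun x hx => by
    have hd : (star T) (T x) - x ∈ Kᗮ := Kᗮ.sub_mem (hmem _) hx
    rw [← sub_eq_zero, ← inner_self_eq_zero (𝕜 := ℂ), inner_sub_left, inner_star_left,
      hinner _ hx _ hd, sub_self]
  refine ContinuousLinearMap.ext fun x => ?_
  obtain ⟨y, hy, z, hz, rfl⟩ := K.exists_add_mem_mem_orthogonal x
  have hy' : T y = 0 := hy
  change T ((star T) (T (y + z))) = T (y + z)
  rw [map_add, hy', zero_add, hfix z hz]

variable {T : E →L[ℂ] E}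

theorem IsPartialIsom.apply_star_apply (hT : IsPartialIsom T) (x : E) : T ((star T) (T x)) = T x :=
  congrArg (fun S : E →L[ℂ] E => S x) hT

/-- A partial isometry is inverted by its adjoint on the complement of its kernel. -/
theorem IsPartialIsom.star_apply_apply (hT : IsPartialIsom T) {x : E}
    (hx : ∀ w, T w = 0 → inner ℂ x w = 0) : (star T) (T x) = x := by
  have h1 : T ((star T) (T x) - x) = 0 := by rw [map_sub, hT.apply_star_apply, sub_self]
  rw [← sub_eq_zero, ← inner_self_eq_zero (𝕜 := ℂ), inner_sub_left, inner_star_left, h1,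
    inner_zero_right, hx _ h1, sub_self]

theorem IsPartialIsom.norm_apply (hT : IsPartialIsom T) {x : E}
    (hx : ∀ w, T w = 0 → inner ℂ x w = 0) : ‖T x‖ = ‖x‖ := by
  rw [@norm_eq_sqrt_re_inner ℂ, @norm_eq_sqrt_re_inner ℂ _ _ _ _ x, ← inner_star_left,
    hT.star_apply_apply hx]

/-- If `S`, `T`, `S T` are partial isometries, then `S T T⋆` factors through the initial projection
of `S`. -/
theorem IsPartialIsom.apply_final_projection {S : E →L[ℂ] E} (hS : IsPartialIsom S)
    (hT : IsPartialIsom T) (hST : IsPartialIsom (S * T)) (x : E) :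
    S (T ((star T) ((star S) (S x)))) = S (T ((star T) x)) := by
  have hc := commute_projections_of_mul hS hT hST
  have h1 := congrArg (fun R : E →L[ℂ] E => S (R x)) hc.eq
  change S ((star S) (S (T ((star T) x)))) = S (T ((star T) ((star S) (S x)))) at h1
  rw [← h1, hS.apply_star_apply]

/-- If `T ^ (i + j)`, `T ^ i`, `T ^ j` are partial isometries, then `T ^ i` maps the complement of
`ker T ^ (i + j)` into the complement of `ker T ^ j`. -/
theorem inner_pow_apply_eq_zero {i j : ℕ} (hi : IsPartialIsom (T ^ i)) (hj : IsPartialIsom (T ^ j))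
    (hij : IsPartialIsom (T ^ (i + j))) {x : E}
    (hx : ∀ w, (T ^ (i + j)) w = 0 → inner ℂ x w = 0) {w : E} (hw : (T ^ j) w = 0) :
    inner ℂ ((T ^ i) x) w = 0 := by
  have h0 : inner ℂ x ((star (T ^ i)) w) = 0 := by
    apply hx
    rw [add_comm, pow_add]
    change (T ^ j) ((T ^ i) ((star (T ^ i)) w)) = 0
    -- The final projection of `T ^ i` commutes with the initial projection of `T ^ j`, so it
    -- preserves `ker T ^ j`.
    rw [← hj.apply_final_projection hi (by rwa [← pow_add, add_comm]), hw]
    simp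
  rwa [inner_star_right] at h0

omit [CompleteSpace E] in
theorem pow_apply_pow (i j : ℕ) (x : E) : (T ^ i) ((T ^ j) x) = (T ^ (i + j)) x := by
  rw [pow_add]; rfl

omit [CompleteSpace E] in
theorem apply_pow (i : ℕ) (x : E) : T ((T ^ i) x) = (T ^ (i + 1)) x := by
  rw [pow_succ']; rfl

omit [CompleteSpace E] in
theorem pow_apply_eq_zero {i j : ℕ} (hij : i ≤ j) {x : E} (h : (T ^ i) x = 0) :
    (T ^ j) x = 0 := by
  obtain ⟨k, rfl⟩ := Nat.exists_eq_add_of_le' hij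
  rw [← pow_apply_pow, h, map_zero]

end Operator

/-! ### Orthogonal chains `x, T x, …, T ^ m x`. -/

section Chain

variable {E : Type*} [NormedAddCommGroup E] [InnerProductSpace ℂ E] [CompleteSpace E]
  {T : E →L[ℂ] E} {m : ℕ} {x : E}

theorem norm_pow_apply_of_chain (hT : ∀ j ≤ m, IsPartialIsom (T ^ j))
    (hx : ∀ w, (T ^ m) w = 0 → inner ℂ x w = 0) {j : ℕ} (hj : j ≤ m) : ‖(T ^ j) x‖ = ‖x‖ :=
  (hT j hj).norm_apply fun w hw => hx w (pow_apply_eq_zero hj hw)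

/-- For `i < j` and `i ≤ m`, the vector `T ^ i x` is orthogonal to `ker T ^ (m - i)`, which contains
`T ^ j x`. -/
theorem inner_pow_apply_of_chain (hT : ∀ j ≤ m, IsPartialIsom (T ^ j))
    (hx : ∀ w, (T ^ m) w = 0 → inner ℂ x w = 0) (hx' : (T ^ (m + 1)) x = 0) {i j : ℕ}
    (hij : i ≠ j) : inner ℂ ((T ^ i) x) ((T ^ j) x) = 0 := by
  wlog h : i < j generalizing i j
  · rw [← inner_conj_symm, this hij.symm (by omega), map_zero]
  by_cases hi : i ≤ m
  · have him : i + (m - i) = m := by omega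
    refine inner_pow_apply_eq_zero (j := m - i) (hT i hi) (hT _ (by omega)) ?_ ?_ ?_
    · rw [him]; exact hT m le_rfl
    · rwa [him]
    · rw [pow_apply_pow]; exact pow_apply_eq_zero (by omega) hx'
  · rw [pow_apply_eq_zero (by omega) hx', inner_zero_left]

/-- `T ^ j x` is orthogonal to `ker T ^ (m - j)`, which contains `ker T` because `j < m`; so `T⋆`
undoes `T` there. -/
theorem star_apply_pow_of_chain (hT : ∀ j ≤ m, IsPartialIsom (T ^ j))
    (hx : ∀ w, (T ^ m) w = 0 → inner ℂ x w = 0) {j : ℕ} (hj : j < m) :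
    (star T) ((T ^ (j + 1)) x) = (T ^ j) x := by
  rw [← apply_pow]
  have h1 : IsPartialIsom T := by simpa using hT 1 (by omega)
  refine h1.star_apply_apply fun w hw => ?_
  have hjm : j + (m - j) = m := by omega
  refine inner_pow_apply_eq_zero (j := m - j) (hT j hj.le) (hT _ (by omega)) ?_ ?_ ?_
  · rw [hjm]; exact hT m le_rfl
  · rwa [hjm]
  · exact pow_apply_eq_zero (i := 1) (by omega) (by simpa using hw)

end Chain

/-! ### Rayleigh quotients of discrete sine vectors. -/

section Rayleigh

variable {E : Type*} [NormedAddCommGroup E] [InnerProductSpace ℂ E]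

theorem inner_sum_smul_of_orthogonal {f : ℕ → E} (hf : ∀ i j, i ≠ j → inner ℂ (f i) (f j) = 0)
    (n : ℕ) (c d : ℕ → ℝ) :
    inner ℂ (∑ j ∈ Finset.range n, (c j : ℂ) • f j) (∑ j ∈ Finset.range n, (d j : ℂ) • f j)
      = ((∑ j ∈ Finset.range n, c j * d j * ‖f j‖ ^ 2 : ℝ) : ℂ) := by
  rw [sum_inner]
  push_cast
  refine Finset.sum_congr rfl fun i hi => ?_
  rw [inner_sum, Finset.sum_eq_single i]
  · rw [inner_smul_left, inner_smul_right, inner_self_eq_norm_sq_to_K, Complex.conj_ofReal]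
    simp [mul_assoc]
  · intro j _ hji
    rw [inner_smul_left, inner_smul_right, hf i j hji.symm, mul_zero, mul_zero]
  · exact fun h => absurd hi h

theorem two_mul_cos_mul_sin (φ x : ℝ) :
    2 * Real.cos φ * Real.sin (x * φ) = Real.sin ((x + 1) * φ) + Real.sin ((x - 1) * φ) := by
  rw [add_mul, sub_mul, one_mul, Real.sin_add, Real.sin_sub]; ring

/-- The sines form an eigenvector of the path graph with eigenvalue `2 cos φ`; the last product is
the boundary term, which vanishes for the angles used. -/
theorem sum_sin_mul_sin_succ (φ : ℝ) (m : ℕ) :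
    2 * ∑ j ∈ Finset.range m, Real.sin ((j + 1 + 1) * φ) * Real.sin ((j + 1) * φ)
      = 2 * Real.cos φ * (∑ j ∈ Finset.range m, Real.sin ((j + 1 + 1) * φ) ^ 2 + Real.sin φ ^ 2)
        - Real.sin ((m + 1 + 1) * φ) * Real.sin ((m + 1) * φ) := by
  induction m with
  | zero =>
    have := two_mul_cos_mul_sin φ 1
    simp only [Finset.range_zero, Finset.sum_empty, sub_self, zero_mul, Real.sin_zero, one_mul,
      Nat.cast_zero, zero_add] at this ⊢
    rw [add_zero] at this
    rw [← this]; ring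
  | succ m ih =>
    rw [Finset.sum_range_succ, Finset.sum_range_succ, mul_add, ih]
    have := two_mul_cos_mul_sin φ (m + 1 + 1)
    rw [show (m + 1 + 1 - 1 : ℝ) = m + 1 by ring] at this
    push_cast
    linear_combination (-Real.sin ((m + 1 + 1) * φ)) * this

/-- The Rayleigh quotient of the discrete sine vector along an orthogonal chain `f 0, …, f m`
shifted by `S`, where `f 0` may in addition have a diagonal entry `β`. -/
theorem re_inner_sine_vector {S : E →L[ℂ] E} {f : ℕ → E} {m : ℕ} {β b φ : ℝ}
    (hf : ∀ i j, i ≠ j → inner ℂ (f i) (f j) = 0) (h0 : S (f 0) = (β : ℂ) • f 0 + f 1)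
    (hS : ∀ j, S (f (j + 1)) = f (j + 2)) (hz : f (m + 1) = 0)
    (hn : ∀ j < m, ‖f (j + 1)‖ ^ 2 = b) (hb : b = (1 - β ^ 2) * ‖f 0‖ ^ 2)
    (hφ : Real.sin ((m + 1 + 1) * φ) = 0) (v : E)
    (hv : v = ∑ j ∈ Finset.range (m + 1), (Real.sin ((j + 1) * φ) : ℂ) • f j) :
    (inner ℂ v (S v)).re
      = Real.cos φ * ‖v‖ ^ 2 + Real.sin φ ^ 2 * ‖f 0‖ ^ 2 * (β * (1 - Real.cos φ * β)) := by
  -- `d` lists the coefficients of `S v`: the sines shifted by one place, with the contribution of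
  -- `β` in front.
  obtain ⟨d, hd0, hd⟩ : ∃ d : ℕ → ℝ, d 0 = Real.sin φ * β ∧
      ∀ j : ℕ, d (j + 1) = Real.sin ((j + 1) * φ) :=
    ⟨fun j => Nat.casesOn j (Real.sin φ * β) fun i => Real.sin ((i + 1) * φ), rfl, fun _ => rfl⟩
  have hSv : S v = ∑ j ∈ Finset.range (m + 1), (d j : ℂ) • f j := by
    rw [hv, map_sum, Finset.sum_range_succ', Finset.sum_range_succ']
    simp only [map_smul, hS, h0, hd0, hd, Nat.cast_zero, zero_add, one_mul, Nat.cast_add, Nat.cast_one]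
    have := Finset.sum_range_succ' (fun j : ℕ => (Real.sin ((j + 1) * φ) : ℂ) • f (j + 1)) m
    rw [Finset.sum_range_succ, hz, smul_zero, add_zero] at this
    rw [this]
    simp only [Nat.cast_zero, zero_add, one_mul, Nat.cast_add, Nat.cast_one, smul_add, smul_smul]
    push_cast
    module
  have hvv : ‖v‖ ^ 2 = ∑ j ∈ Finset.range (m + 1),
      Real.sin ((j + 1) * φ) * Real.sin ((j + 1) * φ) * ‖f j‖ ^ 2 := by
    have h1 := inner_self_eq_norm_sq_to_K (𝕜 := ℂ) v
    rw [hv, inner_sum_smul_of_orthogonal hf, ← hv] at h1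
    exact Complex.ofReal_injective (by rw [h1]; simp)
  have hvS : (inner ℂ v (S v)).re = ∑ j ∈ Finset.range (m + 1), Real.sin ((j + 1) * φ) *
      d j * ‖f j‖ ^ 2 := by
    rw [hSv, hv, inner_sum_smul_of_orthogonal hf, Complex.ofReal_re]
  have hsum := sum_sin_mul_sin_succ φ m
  rw [hφ, zero_mul, sub_zero] at hsum
  rw [hvv, hvS, Finset.sum_range_succ', Finset.sum_range_succ']
  have e1 : ∑ k ∈ Finset.range m, Real.sin (((k + 1 : ℕ) + 1) * φ) * Real.sin ((k + 1) * φ) *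
      ‖f (k + 1)‖ ^ 2 =
      b * ∑ j ∈ Finset.range m, Real.sin ((j + 1 + 1) * φ) * Real.sin ((j + 1) * φ) := by
    rw [Finset.mul_sum]
    refine Finset.sum_congr rfl fun k hk => ?_
    rw [hn k (Finset.mem_range.1 hk)]; push_cast; ring
  have e2 : ∑ k ∈ Finset.range m, Real.sin (((k + 1 : ℕ) + 1) * φ) *
      Real.sin (((k + 1 : ℕ) + 1) * φ) * ‖f (k + 1)‖ ^ 2 =
      b * ∑ j ∈ Finset.range m, Real.sin ((j + 1 + 1) * φ) ^ 2 := by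
    rw [Finset.mul_sum]
    refine Finset.sum_congr rfl fun k hk => ?_
    rw [hn k (Finset.mem_range.1 hk)]; push_cast; ring
  rw [e2]
  simp only [Nat.cast_zero, zero_add, one_mul, hd0, hd]
  rw [e1]
  linear_combination (b / 2) * hsum + Real.cos φ * Real.sin φ ^ 2 * hb

variable [CompleteSpace E]

/-- A maximizer of the Rayleigh quotient of the self-adjoint operator `S + S⋆` is an eigenvector. -/
theorem add_star_apply_of_isMax {S : E →L[ℂ] E} {r : ℝ}
    (h : ∀ y, (inner ℂ y (S y)).re ≤ r * ‖y‖ ^ 2) {x : E}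
    (hx : (inner ℂ x (S x)).re = r * ‖x‖ ^ 2) : S x + (star S) x = ((2 * r : ℝ) : ℂ) • x := by
  have hsa : IsSelfAdjoint (S + star S) := IsSelfAdjoint.add_star_self S
  have hre : ∀ y, (S + star S).reApplyInnerSelf y = 2 * (inner ℂ y (S y)).re := fun y => by
    rw [ContinuousLinearMap.reApplyInnerSelf_apply]
    change (inner ℂ (S y + (star S) y) y).re = _
    rw [inner_add_left, inner_star_left, ← inner_conj_symm (S y) y, Complex.add_re,
      Complex.conj_re]
    ring
  by_cases hx0 : x = 0
  · simp [hx0]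
  have hmax : IsMaxOn (S + star S).reApplyInnerSelf (Metric.sphere 0 ‖x‖) x := fun y hy => by
    have hy' : ‖y‖ = ‖x‖ := by simpa using hy
    change (S + star S).reApplyInnerSelf y ≤ (S + star S).reApplyInnerSelf x
    rw [hre, hre, hx, ← hy']
    linarith [h y]
  have := hsa.eq_smul_self_of_isLocalExtrOn (Or.inr hmax.localize)
  rw [ContinuousLinearMap.rayleighQuotient, hre, hx, ← mul_assoc,
    mul_div_cancel_right₀ _ (pow_ne_zero 2 (norm_ne_zero_iff.2 hx0))] at this
  exact this

end Rayleigh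

/-! ### The Chebyshev recurrence and the upper bound for the radius. -/

section Chebyshev

open Polynomial

theorem chebyshev_U_succ_succ (r : ℝ) (k : ℕ) :
    (Chebyshev.U ℝ ((k + 2 : ℕ) : ℤ)).eval r
      = 2 * r * (Chebyshev.U ℝ ((k + 1 : ℕ) : ℤ)).eval r
        - (Chebyshev.U ℝ (k : ℤ)).eval r := by
  push_cast
  rw [Chebyshev.U_add_two]
  simp

/-- A Sturm comparison: at `cos φ` the polynomials are proportional to `sin ((k + 1) φ)`, positive
for `k < a`. For `r > cos φ` the ratio of consecutive values exceeds that of the sines. -/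
theorem chebyshev_U_pos {a : ℕ} {r : ℝ} (hr : Real.cos (Real.pi / (a + 1)) < r) {k : ℕ}
    (hk : k ≤ a) : 0 < (Chebyshev.U ℝ (k : ℤ)).eval r := by
  set φ := Real.pi / (a + 1) with hφ
  have hφ0 : 0 < φ := by positivity
  have haφ : (a + 1) * φ = Real.pi := by rw [hφ]; field_simp
  have hsin : ∀ j : ℕ, j < a → 0 < Real.sin ((j + 1) * φ) := fun j hj => by
    refine Real.sin_pos_of_pos_of_lt_pi (by positivity) ?_
    rw [← haφ]
    have : (j : ℝ) < a := by exact_mod_cast hj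
    gcongr
  have key : ∀ j : ℕ, j < a → 0 < (Chebyshev.U ℝ (j : ℤ)).eval r ∧
      (Chebyshev.U ℝ (j : ℤ)).eval r * Real.sin ((j + 1 + 1) * φ)
        < (Chebyshev.U ℝ ((j + 1 : ℕ) : ℤ)).eval r * Real.sin ((j + 1) * φ) := by
    intro j
    induction j with
    | zero =>
      intro h
      have h1 := two_mul_cos_mul_sin φ 1
      have h2 := hsin 0 h
      norm_num at h1 h2 ⊢
      rw [← h1]
      gcongr
    | succ j ih =>
      intro h
      obtain ⟨h1, h2⟩ := ih (by omega)
      have h3 := hsin j (by omega)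
      have h4 := hsin (j + 1) h
      push_cast at h4
      have h5 : 0 < (Chebyshev.U ℝ ((j + 1 : ℕ) : ℤ)).eval r := by
        have : 0 < (Chebyshev.U ℝ ((j + 1 : ℕ) : ℤ)).eval r * Real.sin ((j + 1) * φ) :=
          (mul_pos h1 h4).trans h2
        exact pos_of_mul_pos_left this h3.le
      refine ⟨h5, ?_⟩
      rw [chebyshev_U_succ_succ]
      have h6 := two_mul_cos_mul_sin φ (j + 1 + 1)
      rw [show (j + 1 + 1 - 1 : ℝ) = j + 1 by ring] at h6
      have h7 := mul_pos (mul_pos (sub_pos.2 hr) h5) h4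
      push_cast at *
      nlinarith [h2, h6, h7]
  rcases k with _ | k
  · simp
  · obtain ⟨h1, h2⟩ := key k hk
    have h3 := hsin k hk
    -- For `k + 1 = a` this sine is `sin π = 0`, so only the weak inequality is available.
    have h4 : 0 ≤ Real.sin ((k + 1 + 1) * φ) := by
      refine Real.sin_nonneg_of_nonneg_of_le_pi (by positivity) ?_
      rw [← haφ]
      have : (k + 1 : ℝ) ≤ a := by exact_mod_cast hk
      gcongr
    exact pos_of_mul_pos_left ((mul_nonneg h1.le h4).trans_lt h2) h3.le

variable {E : Type*} [NormedAddCommGroup E] [InnerProductSpace ℂ E] [CompleteSpace E]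
  {T : E →L[ℂ] E} {a : ℕ} {r : ℝ} {x : ℕ → E}

/-- The term to control is `T ^ (k + 1) T⋆ x_k`. Commuting projections rewrite it as `U_k(r) T ^ (k
+ 1) (T ^ (k + 1))⋆ x_0`, and `x_0` lies in the range of `T ^ (k + 1)` because `U_{k+1}(r) ≠ 0`. -/
theorem pow_apply_of_recurrence (hT : ∀ j < a, IsPartialIsom (T ^ j))
    (h1 : T (x 1) = ((2 * r : ℝ) : ℂ) • x 0)
    (h2 : ∀ j, T (x (j + 2)) = ((2 * r : ℝ) : ℂ) • x (j + 1) - (star T) (x j))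
    (hU : ∀ k ≤ a, (Chebyshev.U ℝ (k : ℤ)).eval r ≠ 0) {k : ℕ} (hk : k ≤ a) :
    (T ^ k) (x k) = (((Chebyshev.U ℝ (k : ℤ)).eval r : ℝ) : ℂ) • x 0 := by
  induction k using Nat.twoStepInduction with
  | zero => simp
  | one => simp [h1]
  | more k ih1 ih2 =>
    have ih1 := ih1 (by omega)
    have ih2 := ih2 (by omega)
    have hk1 : IsPartialIsom (T ^ (k + 1)) := hT _ (by omega)
    have hx0 : (T ^ (k + 1)) ((star (T ^ (k + 1))) (x 0)) = x 0 := by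
      have hne : (((Chebyshev.U ℝ ((k + 1 : ℕ) : ℤ)).eval r : ℝ) : ℂ) ≠ 0 :=
        Complex.ofReal_ne_zero.2 (hU _ (by omega))
      have h3 : x 0 = (T ^ (k + 1))
          ((((Chebyshev.U ℝ ((k + 1 : ℕ) : ℤ)).eval r : ℝ) : ℂ)⁻¹ • x (k + 1)) := by
        rw [map_smul, ih2, inv_smul_smul₀ hne]
      rw [h3, hk1.apply_star_apply]
    have hstar : (T ^ (k + 1)) ((star T) (x k))
        = (((Chebyshev.U ℝ (k : ℤ)).eval r : ℝ) : ℂ) • x 0 := by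
      have hT1 : IsPartialIsom T := by simpa using hT 1 (by omega)
      have h3 := (hT k (by omega)).apply_final_projection hT1 (by rwa [← pow_succ]) (x k)
      have h4 : ∀ y, (T ^ (k + 1)) y = (T ^ k) (T y) := fun y => by rw [pow_succ]; rfl
      rw [h4, ← h3, ih1, map_smul, map_smul, map_smul, map_smul, ← h4]
      congr 1
      rw [pow_succ, star_mul, ← pow_succ] at hx0
      exact hx0
    have h5 : (T ^ (k + 2)) (x (k + 2)) = (T ^ (k + 1)) (T (x (k + 2))) := by
      rw [pow_succ]; rfl
    rw [h5, h2, map_sub, map_smul, ih2, hstar, chebyshev_U_succ_succ, smul_smul, ← sub_smul]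
    push_cast
    rfl

theorem le_cos_of_recurrence (hT : ∀ j < a, IsPartialIsom (T ^ j))
    (hker : ∀ y, (T ^ (a + 1)) y = 0 → (T ^ a) y = 0) (hne : x 0 ≠ 0) (h0 : T (x 0) = 0)
    (h1 : T (x 1) = ((2 * r : ℝ) : ℂ) • x 0)
    (h2 : ∀ j, T (x (j + 2)) = ((2 * r : ℝ) : ℂ) • x (j + 1) - (star T) (x j)) :
    r ≤ Real.cos (Real.pi / (a + 1)) := by
  by_contra hr
  have hU : ∀ k ≤ a, (Chebyshev.U ℝ (k : ℤ)).eval r ≠ 0 := fun k hk =>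
    (chebyshev_U_pos (not_le.1 hr) hk).ne'
  have h3 := pow_apply_of_recurrence hT h1 h2 hU le_rfl
  have h4 : (T ^ (a + 1)) (x a) = 0 := by rw [← apply_pow, h3, map_smul, h0, smul_zero]
  rw [hker _ h4] at h3
  exact (smul_ne_zero (Complex.ofReal_ne_zero.2 (hU a le_rfl)) hne) h3.symm

end Chebyshev

/-! ### Chains and the numerical radius. -/

section NumericalRadius

variable {E : Type*} [NormedAddCommGroup E] [InnerProductSpace ℂ E] [CompleteSpace E]
  {T : E →L[ℂ] E} {m : ℕ} {x : E}

/-- When `T ^ m` is a partial isometry, `(T ^ m)⋆ T ^ m y` is the projection of `y` off `ker T ^ m`.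
This lemma and the next make it the top of a chain when `T ^ (m + 1) y = 0`. -/
theorem inner_star_pow_mul_pow_apply_eq_zero (m : ℕ) (y : E) {w : E} (hw : (T ^ m) w = 0) :
    inner ℂ ((star (T ^ m)) ((T ^ m) y)) w = 0 := by
  rw [inner_star_left, hw, inner_zero_right]

theorem pow_succ_star_pow_mul_pow_apply (hT : IsPartialIsom (T ^ m)) {y : E}
    (hy : (T ^ (m + 1)) y = 0) : (T ^ (m + 1)) ((star (T ^ m)) ((T ^ m) y)) = 0 := by
  rw [← apply_pow, hT.apply_star_apply, apply_pow, hy]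

/-- The discrete sine vector on the chain `x, T x, …, T ^ m x`. -/
noncomputable def sineVector (T : E →L[ℂ] E) (m : ℕ) (x : E) : E :=
  ∑ j ∈ Finset.range (m + 1), (Real.sin ((j + 1) * (Real.pi / (m + 1 + 1))) : ℂ) • (T ^ j) x

theorem re_inner_sineVector (hT : ∀ j ≤ m, IsPartialIsom (T ^ j))
    (hx : ∀ w, (T ^ m) w = 0 → inner ℂ x w = 0) (hx' : (T ^ (m + 1)) x = 0) :
    (inner ℂ (sineVector T m x) (T (sineVector T m x))).re
      = Real.cos (Real.pi / (m + 1 + 1)) * ‖sineVector T m x‖ ^ 2 := by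
  have h := re_inner_sine_vector (S := T) (f := fun j => (T ^ j) x) (m := m) (β := 0)
    (b := ‖x‖ ^ 2) (φ := Real.pi / (m + 1 + 1))
    (fun i j hij => inner_pow_apply_of_chain hT hx hx' hij) (by simp)
    (fun j => apply_pow _ _) hx' (fun j hj => by rw [norm_pow_apply_of_chain hT hx hj]) (by simp)
    (by rw [mul_div_cancel₀ _ (by positivity)]; simp) (sineVector T m x) rfl
  rw [h]; simp

theorem sineVector_ne_zero (hT : ∀ j ≤ m, IsPartialIsom (T ^ j))
    (hx : ∀ w, (T ^ m) w = 0 → inner ℂ x w = 0) (hx' : (T ^ (m + 1)) x = 0) (h0 : x ≠ 0) :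
    sineVector T m x ≠ 0 := by
  intro hv
  have h1 : inner ℂ x (sineVector T m x) = 0 := by rw [hv, inner_zero_right]
  rw [sineVector, inner_sum, Finset.sum_eq_single 0] at h1
  · rw [inner_smul_right, pow_zero, one_apply_eq_self] at h1
    rcases mul_eq_zero.1 h1 with h | h
    · have hs : 0 < Real.sin (((0 : ℕ) + 1) * (Real.pi / (m + 1 + 1))) := by
        refine Real.sin_pos_of_pos_of_lt_pi (by positivity) ?_
        rw [Nat.cast_zero, zero_add, one_mul]
        refine div_lt_self Real.pi_pos ?_
        have : (0 : ℝ) ≤ m := Nat.cast_nonneg m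
        linarith
      exact hs.ne' (Complex.ofReal_eq_zero.1 h)
    · exact h0 (inner_self_eq_zero.1 h)
  · intro j _ hj
    rw [inner_smul_right]
    have := inner_pow_apply_of_chain hT hx hx' (Ne.symm hj)
    rw [pow_zero, one_apply_eq_self] at this
    rw [this, mul_zero]
  · simp

theorem cos_le_of_chain (hT : ∀ j ≤ m, IsPartialIsom (T ^ j))
    (hx : ∀ w, (T ^ m) w = 0 → inner ℂ x w = 0) (hx' : (T ^ (m + 1)) x = 0) (h0 : x ≠ 0) {r : ℝ}
    (hr : ∀ y, (inner ℂ y (T y)).re ≤ r * ‖y‖ ^ 2) : Real.cos (Real.pi / (m + 1 + 1)) ≤ r := by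
  have h1 := hr (sineVector T m x)
  rw [re_inner_sineVector hT hx hx'] at h1
  have h2 := norm_pos_iff.2 (sineVector_ne_zero hT hx hx' h0)
  exact le_of_mul_le_mul_right h1 (by positivity)

/-- If the numerical range lies to the left of `cos (π / (m + 2))`, the top of a chain of length
`m + 1` is annihilated by the adjoint. -/
theorem star_apply_eq_zero_of_chain (hT : ∀ j ≤ m, IsPartialIsom (T ^ j))
    (hx : ∀ w, (T ^ m) w = 0 → inner ℂ x w = 0) (hx' : (T ^ (m + 1)) x = 0)
    (hr : ∀ y, (inner ℂ y (T y)).re ≤ Real.cos (Real.pi / (m + 1 + 1)) * ‖y‖ ^ 2) :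
    (star T) x = 0 := by
  have hmax := add_star_apply_of_isMax hr (re_inner_sineVector hT hx hx')
  set φ := Real.pi / (m + 1 + 1) with hφ
  have hφπ : ((m + 1 : ℕ) + 1) * φ = Real.pi := by
    push_cast
    rw [hφ, mul_div_cancel₀ _ (by positivity)]
  have hs1 : 0 < Real.sin φ := by
    refine Real.sin_pos_of_pos_of_lt_pi (by positivity) (div_lt_self Real.pi_pos ?_)
    have : (0 : ℝ) ≤ m := Nat.cast_nonneg m
    linarith
  let s : ℕ → ℝ := fun j => Real.sin ((j + 1) * φ)
  let t : ℕ → ℝ := fun j => Real.sin (j * φ)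
  have hv : sineVector T m x = ∑ j ∈ Finset.range (m + 1), (s j : ℂ) • (T ^ j) x := rfl
  have hTv : T (sineVector T m x) = ∑ j ∈ Finset.range (m + 1), (t j : ℂ) • (T ^ j) x := by
    rw [hv, map_sum, Finset.sum_range_succ, Finset.sum_range_succ']
    simp only [map_smul, apply_pow, hx', smul_zero, add_zero, t, s, Nat.cast_zero, zero_mul,
      Real.sin_zero, Complex.ofReal_zero, zero_smul, Nat.cast_succ]
  have hTs : (star T) (sineVector T m x) = (Real.sin φ : ℂ) • (star T) x
      + ∑ j ∈ Finset.range (m + 1), (s (j + 1) : ℂ) • (T ^ j) x := by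
    rw [hv, map_sum, Finset.sum_range_succ', Finset.sum_range_succ]
    have e1 : s (m + 1) = 0 := by simp only [s]; rw [hφπ, Real.sin_pi]
    have e2 : ∑ k ∈ Finset.range m, (star T) ((s (k + 1) : ℂ) • (T ^ (k + 1)) x)
        = ∑ k ∈ Finset.range m, (s (k + 1) : ℂ) • (T ^ k) x :=
      Finset.sum_congr rfl fun k hk => by
        rw [map_smul, star_apply_pow_of_chain hT hx (Finset.mem_range.1 hk)]
    rw [e1, e2]
    simp [s, add_comm]
  have h2v : ((2 * Real.cos φ : ℝ) : ℂ) • sineVector T m x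
      = ∑ j ∈ Finset.range (m + 1), (t j : ℂ) • (T ^ j) x
        + ∑ j ∈ Finset.range (m + 1), (s (j + 1) : ℂ) • (T ^ j) x := by
    rw [hv, Finset.smul_sum, ← Finset.sum_add_distrib]
    refine Finset.sum_congr rfl fun j _ => ?_
    rw [smul_smul, ← add_smul, ← Complex.ofReal_mul, ← Complex.ofReal_add]
    congr 2
    simp only [s, t]
    rw [two_mul_cos_mul_sin, add_sub_cancel_right]
    push_cast
    ring
  -- The sine vector attains the maximum, so it is an eigenvector of `T + T⋆`; by the sine
  -- recurrence everything cancels except `sin φ • T⋆ x`.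
  rw [hTv, hTs, h2v] at hmax
  have h3 : (Real.sin φ : ℂ) • (star T) x = 0 := by
    rw [add_left_comm, add_eq_right] at hmax
    exact hmax
  exact (smul_eq_zero.1 h3).resolve_left (Complex.ofReal_ne_zero.2 hs1.ne')

end NumericalRadius

/-! ### Forcing nilpotency. -/

section Reduction

variable {E : Type*} [NormedAddCommGroup E] [InnerProductSpace ℂ E] [FiniteDimensional ℂ E]

theorem exists_compression_eigenvector (T : E →L[ℂ] E) {K : Submodule ℂ E} (hK : K ≠ ⊤) :
    ∃ y ∈ Kᗮ, y ≠ 0 ∧ ∃ c : ℂ, T y - c • y ∈ K := by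
  have hne : Kᗮ ≠ ⊥ := fun h => hK (Submodule.orthogonal_eq_bot_iff.1 h)
  have : Nontrivial Kᗮ := Submodule.nontrivial_iff_ne_bot.2 hne
  obtain ⟨c, hc⟩ := Module.End.exists_eigenvalue
    ((Kᗮ.orthogonalProjectionOnto : E →ₗ[ℂ] Kᗮ) ∘ₗ (T : E →ₗ[ℂ] E) ∘ₗ Kᗮ.subtype)
  obtain ⟨y, hy⟩ := hc.exists_hasEigenvector
  refine ⟨y, y.2, fun h => hy.2 (Subtype.ext h), c, ?_⟩
  have h1 : ((Kᗮ.orthogonalProjectionOnto (T y) : Kᗮ) : E) = c • (y : E) :=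
    congrArg Subtype.val hy.apply_eq_smul
  rw [← h1]
  have h2 := Kᗮ.sub_starProjection_mem_orthogonal (T y)
  rwa [Submodule.orthogonal_orthogonal] at h2

variable [CompleteSpace E] {T : E →L[ℂ] E} {a : ℕ}

omit [FiniteDimensional ℂ E] [CompleteSpace E] in
theorem inner_eq_zero_of_mem_ker_pow_orthogonal {k : ℕ} {y : E}
    (hy : y ∈ (LinearMap.ker ((T ^ k : E →L[ℂ] E) : E →ₗ[ℂ] E))ᗮ) {w : E} (hw : (T ^ k) w = 0) :
    inner ℂ y w = 0 :=
  (Submodule.mem_orthogonal' _ _).1 hy w hw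

/-- If `T, …, T ^ (a + 1)` are partial isometries, `a` being at least the ascent of `T`, then either
`T ^ a = 0` or `T` has a reducing eigenvector with a unimodular eigenvalue. -/
theorem exists_reducing_eigenvector (hT : ∀ j ≤ a + 1, IsPartialIsom (T ^ j))
    (hker : ∀ y, (T ^ (a + 1)) y = 0 → (T ^ a) y = 0) (hne : T ^ a ≠ 0) :
    ∃ (y : E) (c : ℂ), y ≠ 0 ∧ ‖c‖ = 1 ∧ T y = c • y ∧ (star T) y = star c • y := by
  set K := LinearMap.ker ((T ^ a : E →L[ℂ] E) : E →ₗ[ℂ] E) with hKdef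
  have hK : K ≠ ⊤ := fun h => hne (ContinuousLinearMap.ext fun y => by
    have : y ∈ K := h ▸ Submodule.mem_top
    exact this)
  obtain ⟨y, hyK, hy0, c, hc⟩ := exists_compression_eigenvector T hK
  have hT1 : IsPartialIsom T := by simpa using hT 1 (by omega)
  have hyK' : ∀ w, (T ^ (1 + a)) w = 0 → inner ℂ y w = 0 := fun w hw =>
    inner_eq_zero_of_mem_ker_pow_orthogonal hyK (hker w (by rwa [add_comm]))
  -- `T` maps the complement of `ker T ^ (a + 1)`, which equals `Kᗮ`, into `Kᗮ`; the compression
  -- eigenvector is thus a true one.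
  have hTy : T y ∈ Kᗮ := (Submodule.mem_orthogonal' _ _).2 fun w hw => by
    have := inner_pow_apply_eq_zero (i := 1) (hT 1 (by omega)) (hT a (by omega))
      (by rw [add_comm]; exact hT _ le_rfl) hyK' hw
    rwa [pow_one] at this
  have hTyc : T y = c • y := by
    rw [← sub_eq_zero, ← Submodule.mem_bot ℂ, ← K.inf_orthogonal_eq_bot]
    exact ⟨hc, Kᗮ.sub_mem hTy (Kᗮ.smul_mem c hyK)⟩
  have hy1 : ∀ w, T w = 0 → inner ℂ y w = 0 := fun w hw =>
    hyK' w (pow_apply_eq_zero (i := 1) (by omega) (by simpa using hw))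
  have hcn : ‖c‖ = 1 := by
    have h1 := hT1.norm_apply hy1
    rw [hTyc, norm_smul] at h1
    exact (mul_eq_right₀ (norm_ne_zero_iff.2 hy0)).1 h1
  refine ⟨y, c, hy0, hcn, hTyc, ?_⟩
  have h2 := hT1.star_apply_apply hy1
  rw [hTyc, map_smul] at h2
  nth_rw 2 [← h2]
  rw [smul_smul, Complex.star_def, ← Complex.normSq_eq_conj_mul_self, Complex.normSq_eq_norm_sq,
    hcn]
  simp

/-- Otherwise an eigenvector `y` of the compression to the complement of `ker T ^ a` satisfies `T y
= c y + u` with `u` in `ker T ^ a`. The vectors `y, u, T u, …`, suitably rotated, form a chain with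
diagonal entry `‖c‖ > 0` at its start, whose sine vector violates the bound. -/
theorem pow_eq_zero_of_numericalRadius_le (ha : 1 ≤ a) (hT : ∀ j < a, IsPartialIsom (T ^ j))
    (hker : ∀ y, (T ^ (a + 1)) y = 0 → (T ^ a) y = 0)
    (hr : ∀ y, ‖inner ℂ y (T y)‖ ≤ Real.cos (Real.pi / (a + 1)) * ‖y‖ ^ 2) : T ^ a = 0 := by
  obtain ⟨m, rfl⟩ := Nat.exists_eq_add_of_le' ha
  have hre : ∀ y, (inner ℂ y (T y)).re ≤ Real.cos (Real.pi / (m + 1 + 1)) * ‖y‖ ^ 2 := fun y =>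
    (Complex.re_le_norm _).trans (by simpa using hr y)
  have hstar : ∀ x, (∀ w, (T ^ m) w = 0 → inner ℂ x w = 0) → (T ^ (m + 1)) x = 0 →
      (star T) x = 0 := fun x hx hx' =>
    star_apply_eq_zero_of_chain (fun j hj => hT j (by omega)) hx hx' hre
  rcases m with _ | m
  -- For `a = 1` the bound is `cos (π / 2) = 0`, so the quadratic form vanishes.
  · have h0 : (T : E →ₗ[ℂ] E) = 0 := by
      refine inner_map_self_eq_zero (T := (T : E →ₗ[ℂ] E)).1 fun y => ?_
      have := hr y
      rw [← inner_conj_symm]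
      norm_num at this
      simp [this]
    rw [zero_add, pow_one]
    exact ContinuousLinearMap.coe_inj.1 h0
  by_contra hne
  set K := LinearMap.ker ((T ^ (m + 1 + 1) : E →L[ℂ] E) : E →ₗ[ℂ] E) with hKdef
  have hK : K ≠ ⊤ := fun h => hne (ContinuousLinearMap.ext fun y => by
    have : y ∈ K := h ▸ Submodule.mem_top
    exact this)
  obtain ⟨y, hyK, hy0, c, hc⟩ := exists_compression_eigenvector T hK
  have hyK' : ∀ k ≤ m + 2, ∀ w, (T ^ k) w = 0 → inner ℂ y w = 0 := fun k hk w hw =>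
    inner_eq_zero_of_mem_ker_pow_orthogonal hyK (pow_apply_eq_zero hk hw)
  obtain ⟨u, hu⟩ : ∃ u, u = T y - c • y := ⟨_, rfl⟩
  have huK : (T ^ (m + 2)) u = 0 := by rw [hu]; exact hc
  have hTy : T y = c • y + u := by rw [hu, add_sub_cancel]
  have hyu : ∀ j, inner ℂ y ((T ^ j) u) = 0 := fun j => by
    refine hyK' (m + 2) le_rfl _ ?_
    rw [pow_apply_pow]
    exact pow_apply_eq_zero (by omega) huK
  have hyu0 : inner ℂ y u = 0 := by simpa using hyu 0
  have hT1 : IsPartialIsom T := by simpa using hT 1 (by omega)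
  -- The part of `u` off `ker T ^ (m + 1)` is the top `x` of a full-length chain, so `T⋆ x = 0`;
  -- hence `x` is orthogonal to `T y`, to `y`, and so to `u`.
  have hu1 : (T ^ (m + 1)) u = 0 := by
    set x := (star (T ^ (m + 1))) ((T ^ (m + 1)) u) with hxdef
    have hx' : (T ^ (m + 1 + 1)) x = 0 :=
      pow_succ_star_pow_mul_pow_apply (hT (m + 1) (by omega)) huK
    have hsx := hstar x (fun w hw => inner_star_pow_mul_pow_apply_eq_zero _ _ hw) hx'
    have h1 : inner ℂ x u = 0 := by
      rw [hu, inner_sub_right, ← inner_star_left, hsx, inner_zero_left, inner_smul_right,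
        ← inner_conj_symm, hyK' _ le_rfl _ hx']
      simp
    rwa [hxdef, inner_star_left, inner_self_eq_zero] at h1
  have hum : ∀ w, (T ^ m) w = 0 → inner ℂ u w = 0 := fun w hw => by
    have := inner_pow_apply_eq_zero (i := 1) (hT 1 (by omega)) (hT m (by omega))
      (hT _ (by omega)) (hyK' (1 + m) (by omega)) hw
    rw [pow_one] at this
    rw [hu, inner_sub_left, this, inner_smul_left, hyK' m (by omega) w hw]
    simp
  have hTm : ∀ j ≤ m, IsPartialIsom (T ^ j) := fun j hj => hT j (by omega)
  have hc0 : c ≠ 0 := by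
    rintro rfl
    rw [zero_smul, zero_add] at hTy
    have h1 : (T ^ (m + 1 + 1 + 1)) y = 0 := by
      rw [pow_succ]
      change (T ^ (m + 1 + 1)) (T y) = 0
      rw [hTy, huK]
    exact hy0 (inner_self_eq_zero.1 (hyK' _ le_rfl _ (hker _ h1)))
  have hnorm : ‖u‖ ^ 2 = (1 - ‖c‖ ^ 2) * ‖y‖ ^ 2 := by
    have h1 := hT1.norm_apply (x := y) fun w hw => hyK' 1 (by omega) w (by simpa using hw)
    have h2 : ‖T y‖ ^ 2 = ‖c • y‖ ^ 2 + ‖u‖ ^ 2 := by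
      rw [hTy, sq, sq, sq]
      exact norm_add_sq_eq_norm_sq_add_norm_sq_of_inner_eq_zero (𝕜 := ℂ) _ _
        (by rw [inner_smul_left, hyu0, mul_zero])
    rw [h1, norm_smul] at h2
    linarith
  have hcpos : 0 < ‖c‖ := norm_pos_iff.2 hc0
  have hypos : 0 < ‖y‖ := norm_pos_iff.2 hy0
  -- Rotating `T` by this phase makes the diagonal entry `c` positive without changing the numerical
  -- radius.
  set z : ℂ := star c / ‖c‖ with hz
  have hzn : ‖z‖ = 1 := by
    rw [hz, norm_div, norm_star, Complex.norm_real, norm_norm, div_self hcpos.ne']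
  have hzc : z * c = (‖c‖ : ℝ) := by
    have hcne : (‖c‖ : ℂ) ≠ 0 := Complex.ofReal_ne_zero.2 hcpos.ne'
    rw [hz, div_mul_eq_mul_div, Complex.star_def, ← Complex.normSq_eq_conj_mul_self,
      Complex.normSq_eq_norm_sq, div_eq_iff hcne]
    push_cast; ring
  let f : ℕ → E := fun j => Nat.casesOn j y fun i => z ^ (i + 1) • (T ^ i) u
  have hf0 : f 0 = y := rfl
  have hfs : ∀ j, f (j + 1) = z ^ (j + 1) • (T ^ j) u := fun _ => rfl
  have hforth : ∀ i j, i ≠ j → inner ℂ (f i) (f j) = 0 := by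
    intro i j hij
    rcases i with _ | i <;> rcases j with _ | j
    · exact absurd rfl hij
    · rw [hf0, hfs, inner_smul_right, hyu, mul_zero]
    · rw [hf0, hfs, inner_smul_left, ← inner_conj_symm, hyu, map_zero, mul_zero]
    · rw [hfs, hfs, inner_smul_left, inner_smul_right,
        inner_pow_apply_of_chain hTm hum hu1 (by omega), mul_zero, mul_zero]
  have key := re_inner_sine_vector (S := z • T) (f := f) (m := m + 1) (β := ‖c‖) (b := ‖u‖ ^ 2)
    (φ := Real.pi / ((m + 1 + 1 : ℕ) + 1)) hforth
    (by
      rw [hf0, show f 1 = z ^ (0 + 1) • (T ^ 0) u from rfl, smul_apply, hTy, smul_add, smul_smul, hzc]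
      simp)
    (fun j => by
      rw [hfs, hfs, smul_apply, map_smul, apply_pow, smul_smul, ← pow_succ'])
    (by rw [hfs, hu1, smul_zero])
    (fun j hj => by
      rw [hfs, norm_smul, norm_pow, hzn, one_pow, one_mul,
        norm_pow_apply_of_chain hTm hum (by omega)])
    hnorm
    (by push_cast; rw [mul_div_cancel₀ _ (by positivity)]; simp) _ rfl
  generalize (∑ j ∈ Finset.range (m + 1 + 1),
    (Real.sin ((j + 1) * (Real.pi / ((m + 1 + 1 : ℕ) + 1))) : ℂ) • f j) = v at key
  have hle : (inner ℂ v ((z • T) v)).re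
      ≤ Real.cos (Real.pi / ((m + 1 + 1 : ℕ) + 1)) * ‖v‖ ^ 2 := by
    refine (Complex.re_le_norm _).trans ?_
    rw [smul_apply, inner_smul_right, norm_mul, hzn, one_mul]
    exact hr v
  set φ := Real.pi / ((m + 1 + 1 : ℕ) + 1) with hφ
  have hφpos : 0 < φ := by positivity
  have hφpi : φ < Real.pi := by
    refine div_lt_self Real.pi_pos ?_
    push_cast
    have : (0 : ℝ) ≤ m := Nat.cast_nonneg m
    linarith
  have hsin := Real.sin_pos_of_pos_of_lt_pi hφpos hφpi
  have hcos : Real.cos φ < 1 := by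
    rw [← Real.cos_zero]
    exact Real.cos_lt_cos_of_nonneg_of_le_pi le_rfl hφpi.le hφpos
  have hc1 : ‖c‖ ≤ 1 := by
    have h1 : 0 ≤ 1 - ‖c‖ ^ 2 :=
      nonneg_of_mul_nonneg_left (hnorm ▸ sq_nonneg ‖u‖) (by positivity)
    nlinarith
  have h4 : 0 < 1 - Real.cos φ * ‖c‖ := by nlinarith
  -- This is the excess of the Rayleigh quotient over `cos φ` in `key`, contradicting `hle`.
  have h5 : 0 < Real.sin φ ^ 2 * ‖f 0‖ ^ 2 * (‖c‖ * (1 - Real.cos φ * ‖c‖)) := by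
    rw [hf0]; positivity
  linarith

end Reduction

/-! ### Orthogonal Jordan decomposition of nilpotent power partial isometries. -/

section JordanDecomposition

variable {E : Type*} [NormedAddCommGroup E] [InnerProductSpace ℂ E] [FiniteDimensional ℂ E]
  [CompleteSpace E] {T : E →L[ℂ] E}

/-- A unit vector generating a chain of length `k`, i.e. a Jordan block of size `k`. -/
structure IsChainTop (T : E →L[ℂ] E) (k : ℕ) (x : E) : Prop where
  one_le : 1 ≤ k
  norm_eq_one : ‖x‖ = 1
  inner_eq_zero : ∀ w, (T ^ (k - 1)) w = 0 → inner ℂ x w = 0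
  pow_apply : (T ^ k) x = 0

omit [FiniteDimensional ℂ E] in
theorem star_pow_apply_mem {N : Submodule ℂ E} (hN : ∀ x ∈ N, (star T) x ∈ N) (m : ℕ) {x : E}
    (hx : x ∈ N) : (star (T ^ m)) x ∈ N := by
  induction m generalizing x with
  | zero => simpa using hx
  | succ m ih =>
    rw [pow_succ', star_mul]
    exact ih (hN x hx)

omit [FiniteDimensional ℂ E] [CompleteSpace E] in
theorem pow_apply_mem {N : Submodule ℂ E} (hN : ∀ x ∈ N, T x ∈ N) (m : ℕ) {x : E}
    (hx : x ∈ N) : (T ^ m) x ∈ N := by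
  induction m generalizing x with
  | zero => simpa using hx
  | succ m ih =>
    rw [pow_succ]
    exact ih (hN x hx)

omit [FiniteDimensional ℂ E] in
/-- A nonzero reducing subspace of a nilpotent power partial isometry contains the top of a
reducing chain. -/
theorem exists_chainTop_mem (hT : ∀ j, IsPartialIsom (T ^ j)) (hnil : ∃ a, T ^ a = 0)
    {N : Submodule ℂ E} (hN : ∀ x ∈ N, T x ∈ N) (hN' : ∀ x ∈ N, (star T) x ∈ N) (hbot : N ≠ ⊥) :
    ∃ k x, x ∈ N ∧ IsChainTop T k x ∧ (star T) x = 0 := by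
  classical
  have hex : ∃ m, ∀ x ∈ N, (T ^ m) x = 0 := hnil.imp fun a ha x _ => by rw [ha]; rfl
  have hk := Nat.find_spec hex
  have hmin := fun m => Nat.find_min hex (m := m)
  generalize Nat.find hex = k at hk hmin
  rcases k with _ | m
  · exact absurd ((Submodule.eq_bot_iff N).2 fun x hx => by simpa using hk x hx) hbot
  have h1 := hmin m (Nat.lt_succ_self m)
  push Not at h1
  obtain ⟨y, hyN, hy⟩ := h1
  -- `T ^ (m + 1)` is the least power killing `N`; the part of `y` off `ker T ^ m` is the top of a
  -- longest chain in `N`.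
  set x0 := (star (T ^ m)) ((T ^ m) y) with hx0
  have hx0N : x0 ∈ N := star_pow_apply_mem hN' m (pow_apply_mem hN m hyN)
  have hx0ne : x0 ≠ 0 := fun h => hy (by
    rw [← (hT m).apply_star_apply, ← hx0, h, map_zero])
  -- `T T⋆ x0` lies in `ker T ^ m` since `T⋆ x0 ∈ N`, while `x0` is orthogonal to that kernel.
  have hx0T : (star T) x0 = 0 := by
    rw [← inner_self_eq_zero (𝕜 := ℂ), inner_star_left]
    refine inner_star_pow_mul_pow_apply_eq_zero m y ?_
    rw [show ∀ w, (T ^ m) (T w) = (T ^ (m + 1)) w from fun w => by rw [pow_succ]; rfl]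
    exact hk _ (hN' _ hx0N)
  refine ⟨m + 1, (‖x0‖ : ℂ)⁻¹ • x0, N.smul_mem _ hx0N, ⟨by omega, ?_, ?_, ?_⟩, ?_⟩
  · rw [norm_smul, norm_inv, Complex.norm_real, norm_norm,
      inv_mul_cancel₀ (norm_ne_zero_iff.2 hx0ne)]
  · intro w hw
    rw [inner_smul_left, inner_star_pow_mul_pow_apply_eq_zero m y hw, mul_zero]
  · rw [map_smul, hk _ hx0N, smul_zero]
  · rw [map_smul, hx0T, smul_zero]

/-- A reducing subspace of a nilpotent power partial isometry is the orthogonal sum of chains. -/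
theorem exists_chain_decomposition (hT : ∀ j, IsPartialIsom (T ^ j)) (hnil : ∃ a, T ^ a = 0)
    (N : Submodule ℂ E) (hN : ∀ x ∈ N, T x ∈ N) (hN' : ∀ x ∈ N, (star T) x ∈ N) :
    ∃ (s : ℕ) (k : Fin s → ℕ) (x : Fin s → E), (∀ i, IsChainTop T (k i) (x i)) ∧
      (∀ i, x i ∈ N) ∧
      (∀ i i', i ≠ i' → ∀ j j', inner ℂ ((T ^ j) (x i)) ((T ^ j') (x i')) = 0) ∧
      N ≤ Submodule.span ℂ {v | ∃ i j, v = (T ^ j) (x i)} := by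
  induction h : Module.finrank ℂ N using Nat.strong_induction_on generalizing N with
  | _ d ih =>
  by_cases hbot : N = ⊥
  · exact ⟨0, Fin.elim0, Fin.elim0, fun i => i.elim0, fun i => i.elim0, fun i => i.elim0,
      hbot ▸ bot_le⟩
  obtain ⟨k, x, hxN, hx, hxs⟩ := exists_chainTop_mem hT hnil hN hN' hbot
  set C := Submodule.span ℂ (Set.range fun j => (T ^ j) x) with hC
  have hCN : C ≤ N := Submodule.span_le.2 (by
    rintro _ ⟨j, rfl⟩
    exact pow_apply_mem hN j hxN)
  have hmemC : ∀ w, w ∈ Cᗮ ↔ ∀ j, inner ℂ ((T ^ j) x) w = 0 := fun w => by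
    rw [hC, Submodule.mem_orthogonal]
    constructor
    · exact fun h j => h _ (Submodule.subset_span ⟨j, rfl⟩)
    · intro h u hu
      induction hu using Submodule.span_induction with
      | mem u hu => obtain ⟨j, rfl⟩ := hu; exact h j
      | zero => exact inner_zero_left _
      | add u v _ _ hu hv => rw [inner_add_left, hu, hv, add_zero]
      | smul c u _ hu => rw [inner_smul_left, hu, mul_zero]
  -- The chain is also stable under `T⋆`, so its complement in `N` is reducing and the induction
  -- applies to it.
  have hstar : ∀ j, (star T) ((T ^ j) x) = 0 ∨ ∃ i, (star T) ((T ^ j) x) = (T ^ i) x := fun j => by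
    rcases j with _ | j
    · exact Or.inl hxs
    · by_cases hj : j < k - 1
      · exact Or.inr ⟨j, star_apply_pow_of_chain (fun j _ => hT j) hx.inner_eq_zero hj⟩
      · left
        rw [pow_apply_eq_zero (by have := hx.one_le; omega) hx.pow_apply, map_zero]
  have hlt : Module.finrank ℂ (N ⊓ Cᗮ : Submodule ℂ E) < d := by
    rw [← h]
    refine Submodule.finrank_lt_finrank_of_lt (lt_of_le_of_ne inf_le_left fun he => ?_)
    have h1 : x ∈ N ⊓ Cᗮ := by rw [he]; exact hxN
    have h2 := (hmemC x).1 h1.2 0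
    rw [pow_zero, one_apply_eq_self, inner_self_eq_zero] at h2
    have := hx.norm_eq_one
    rw [h2, norm_zero] at this
    exact zero_ne_one this
  obtain ⟨s, κ, ξ, h1, h2, h3, h4⟩ := ih _ hlt (N ⊓ Cᗮ)
    (fun w hw => ⟨hN w hw.1, (hmemC _).2 fun j => by
      rw [← inner_star_left]
      rcases hstar j with h | ⟨i, h⟩
      · rw [h, inner_zero_left]
      · rw [h, (hmemC w).1 hw.2]⟩)
    (fun w hw => ⟨hN' w hw.1, (hmemC _).2 fun j => by
      rw [inner_star_right, apply_pow, (hmemC w).1 hw.2]⟩) rfl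
  have hξ : ∀ j i j', inner ℂ ((T ^ j) x) ((T ^ j') (ξ i)) = 0 := fun j i j' => by
    induction j' generalizing j with
    | zero => simpa using (hmemC _).1 (h2 i).2 j
    | succ j' ih' =>
      rw [← apply_pow, ← inner_star_left]
      rcases hstar j with h | ⟨l, h⟩
      · rw [h, inner_zero_left]
      · rw [h, ih']
  refine ⟨s + 1, Fin.cons k κ, Fin.cons x ξ, ?_, ?_, ?_, ?_⟩
  · exact Fin.cases (by simpa using hx) (by simpa using h1)
  · exact Fin.cases (by simpa using hxN) (fun i => by simpa using (h2 i).1)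
  · intro i i'
    refine Fin.cases ?_ (fun i => ?_) i <;> refine Fin.cases ?_ (fun i' => ?_) i' <;> intro hne j j'
    · exact absurd rfl hne
    · simpa using hξ j i' j'
    · have h := hξ j' i j
      rw [inner_eq_zero_symm] at h
      simpa using h
    · simpa using h3 i i' (fun h => hne (congrArg _ h)) j j'
  · intro w hw
    obtain ⟨c, hc, c', hc', rfl⟩ := C.exists_add_mem_mem_orthogonal w
    refine Submodule.add_mem _ ?_ ?_
    · refine Submodule.span_mono ?_ hc
      rintro _ ⟨j, rfl⟩
      exact ⟨0, j, rfl⟩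
    · have hc'N : c' ∈ N := by simpa using N.sub_mem hw (hCN hc)
      refine Submodule.span_mono ?_ (h4 ⟨hc'N, hc'⟩)
      rintro _ ⟨i, j, rfl⟩
      exact ⟨i.succ, j, by simp⟩

/-- A nilpotent power partial isometry acts on some orthonormal basis as a direct sum of
nilpotent Jordan blocks. -/
theorem exists_jordan_orthonormalBasis (hT : ∀ j, IsPartialIsom (T ^ j)) (hnil : ∃ a, T ^ a = 0) :
    ∃ (s : ℕ) (k : Fin s → ℕ) (b : OrthonormalBasis (Σ i, Fin (k i)) ℂ E), (∀ i, 1 ≤ k i) ∧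
      ∀ (p q : Σ i, Fin (k i)), inner ℂ (b p) (T (b q))
        = if p.1 = q.1 ∧ (p.2 : ℕ) + 1 = q.2 then 1 else 0 := by
  obtain ⟨s, k, x, h1, -, h3, h4⟩ := exists_chain_decomposition hT hnil ⊤
    (fun _ _ => Submodule.mem_top) (fun _ _ => Submodule.mem_top)
  -- Only `j` is bounded: `j' = k i'` is needed later, when `T` annihilates the end of a chain.
  have hinner : ∀ i j i' j', j < k i → inner ℂ ((T ^ j) (x i)) ((T ^ j') (x i'))
      = if i = i' ∧ j = j' then (1 : ℂ) else 0 := by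
    intro i j i' j' hj
    by_cases hi : i = i'
    · subst hi
      by_cases hjj : j = j'
      · subst hjj
        rw [inner_self_eq_norm_sq_to_K, norm_pow_apply_of_chain (fun j _ => hT j)
          (h1 i).inner_eq_zero (by omega), (h1 i).norm_eq_one]
        simp
      · rw [inner_pow_apply_of_chain (fun j _ => hT j) (h1 i).inner_eq_zero _ hjj]
        · simp [hjj]
        · rw [Nat.sub_add_cancel (h1 i).one_le]; exact (h1 i).pow_apply
    · rw [h3 i i' hi]; simp [hi]
  -- The chain is listed backwards, so that `T` lowers the index and the ones land on the
  -- superdiagonal.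
  let f : (Σ i, Fin (k i)) → E := fun p => (T ^ (k p.1 - 1 - p.2)) (x p.1)
  have hf : Orthonormal ℂ f := by
    rw [orthonormal_iff_ite]
    rintro ⟨i, j⟩ ⟨i', j'⟩
    rw [hinner _ _ _ _ (by have := j.2; dsimp only; omega)]
    by_cases hi : i = i'
    · subst hi
      have := j.2
      have := j'.2
      have hiff : k i - 1 - j = k i - 1 - j' ↔ j = j' := by
        rw [Fin.ext_iff]; omega
      simp [hiff]
    · simp [hi]
  have hspan : ⊤ ≤ Submodule.span ℂ (Set.range f) := by
    refine h4.trans (Submodule.span_le.2 ?_)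
    rintro _ ⟨i, j, rfl⟩
    by_cases hj : j < k i
    · refine Submodule.subset_span ⟨⟨i, ⟨k i - 1 - j, by omega⟩⟩, ?_⟩
      simp only [f]
      rw [Nat.sub_sub_self (by omega)]
    · rw [pow_apply_eq_zero (not_lt.1 hj) (h1 i).pow_apply]
      exact Submodule.zero_mem _
  refine ⟨s, k, OrthonormalBasis.mk hf hspan, fun i => (h1 i).one_le, ?_⟩
  rintro ⟨i, j⟩ ⟨i', j'⟩
  rw [OrthonormalBasis.coe_mk]
  simp only [f, apply_pow]
  have := j.2
  have := j'.2
  rw [hinner _ _ _ _ (by omega)]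
  congr 1
  refine propext (and_congr_right fun h => ?_)
  subst h
  omega

end JordanDecomposition

/-! ### Passage between matrices and operators. -/

section MatrixOperator

variable {n : ℕ}

/-- The operator on Euclidean space given by a square matrix. -/
noncomputable abbrev toOp (A : Matrix (Fin n) (Fin n) ℂ) :
    EuclideanSpace ℂ (Fin n) →L[ℂ] EuclideanSpace ℂ (Fin n) :=
  Matrix.toEuclideanCLM (n := Fin n) (𝕜 := ℂ) A

variable {A : Matrix (Fin n) (Fin n) ℂ}

theorem toOp_pow (j : ℕ) : toOp (A ^ j) = toOp A ^ j := map_pow _ _ _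

theorem toOp_star : toOp Aᴴ = star (toOp A) := map_star Matrix.toEuclideanCLM A

theorem toOp_eq_zero_iff : toOp A = 0 ↔ A = 0 :=
  map_eq_zero_iff _ (Matrix.toEuclideanCLM (n := Fin n) (𝕜 := ℂ)).injective

theorem IsPartialIsometry.isPartialIsom (h : IsPartialIsometry A) : IsPartialIsom (toOp A) :=
  isPartialIsom_of_norm_eq h

theorem isPartialIsometry_zero : IsPartialIsometry (0 : Matrix (Fin n) (Fin n) ℂ) := by
  intro x hx
  rw [map_zero, LinearMap.ker_zero, Submodule.top_orthogonal_eq_bot, Submodule.mem_bot] at hx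
  simp [hx]

theorem isPartialIsometry_one : IsPartialIsometry (1 : Matrix (Fin n) (Fin n) ℂ) := by
  intro x _
  rw [Matrix.toLpLin_apply, Matrix.one_mulVec]

theorem ascent_spec (A : Matrix (Fin n) (Fin n) ℂ) :
    LinearMap.ker (Matrix.toEuclideanLin (A ^ ascent A)) =
      LinearMap.ker (Matrix.toEuclideanLin (A ^ (ascent A + 1))) := by
  refine Nat.sInf_mem (s := {k : ℕ | LinearMap.ker (Matrix.toEuclideanLin (A ^ k)) =
    LinearMap.ker (Matrix.toEuclideanLin (A ^ (k + 1)))}) ?_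
  obtain ⟨k, -, hk⟩ := Module.End.exists_ker_pow_eq_ker_pow_succ
    ((toOp A : _ →L[ℂ] _) : EuclideanSpace ℂ (Fin n) →ₗ[ℂ] EuclideanSpace ℂ (Fin n))
  have h : ∀ j, LinearMap.ker (Matrix.toEuclideanLin (A ^ j)) = LinearMap.ker
      (((toOp A : _ →L[ℂ] _) : EuclideanSpace ℂ (Fin n) →ₗ[ℂ] EuclideanSpace ℂ (Fin n)) ^ j) :=
    fun j => by
      rw [← ContinuousLinearMap.toLinearMap_pow, ← toOp_pow]
      rfl
  refine ⟨k, ?_⟩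
  rw [Set.mem_ofPred_eq, h, h]
  exact hk

theorem pow_ascent_apply_eq_zero {y : EuclideanSpace ℂ (Fin n)}
    (hy : (toOp A ^ (ascent A + 1)) y = 0) : (toOp A ^ ascent A) y = 0 := by
  rw [← toOp_pow] at hy ⊢
  have h : y ∈ LinearMap.ker (Matrix.toEuclideanLin (A ^ (ascent A + 1))) := hy
  rw [← ascent_spec] at h
  exact h

theorem exists_of_ascent_eq_succ {m : ℕ} (h : ascent A = m + 1) :
    ∃ y, (toOp A ^ (m + 1)) y = 0 ∧ (toOp A ^ m) y ≠ 0 := by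
  by_contra! hc
  have : m ∈ {k : ℕ | LinearMap.ker (Matrix.toEuclideanLin (A ^ k)) =
      LinearMap.ker (Matrix.toEuclideanLin (A ^ (k + 1)))} := by
    refine le_antisymm (fun y hy => ?_) fun y hy => ?_
    · have h1 : (toOp (A ^ m)) y = 0 := hy
      rw [toOp_pow] at h1
      have h2 := pow_apply_eq_zero (Nat.le_succ m) h1
      rw [← toOp_pow] at h2
      exact h2
    · have h1 : (toOp (A ^ (m + 1))) y = 0 := hy
      rw [toOp_pow] at h1
      have h2 := hc y h1
      rw [← toOp_pow] at h2
      exact h2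
  have h2 : ascent A ≤ m := Nat.sInf_le this
  omega

theorem isPartialIsometry_pow_of_lt_ascent (hA : (ascent A : ℕ∞) ≤ powerIndex A + 1) {j : ℕ}
    (hj : j < ascent A) : IsPartialIsometry (A ^ j) := by
  by_contra hc
  rcases j with _ | j
  · exact hc (by rw [pow_zero]; exact isPartialIsometry_one)
  have h1 : powerIndex A ≤ j := iSup₂_le fun k hk => by
    have : k ≤ j := by
      by_contra hkj
      exact hc (hk (j + 1) (by omega))
    exact_mod_cast this
  have h2 : (ascent A : ℕ∞) ≤ j + 1 := hA.trans (by gcongr)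
  have h3 : ascent A ≤ j + 1 := by exact_mod_cast h2
  omega

theorem powerIndex_eq_top (h : ∀ j, IsPartialIsometry (A ^ j)) : powerIndex A = ⊤ := by
  refine ENat.eq_top_iff_forall_ge.2 fun m => ?_
  exact le_iSup₂_of_le (f := fun (k : ℕ) (_ : k ∈ {k : ℕ | ∀ j ≤ k, IsPartialIsometry (A ^ j)}) =>
    (k : ℕ∞)) m (fun j _ => h j) le_rfl

theorem norm_inner_le_of_numericalRange_subset {r : ℝ}
    (h : numericalRange A ⊆ Metric.closedBall 0 r) (y : EuclideanSpace ℂ (Fin n)) :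
    ‖inner ℂ y (toOp A y)‖ ≤ r * ‖y‖ ^ 2 := by
  by_cases hy : y = 0
  · simp [hy]
  have hy0 : 0 < ‖y‖ := norm_pos_iff.2 hy
  have hmem : inner ℂ ((‖y‖ : ℂ)⁻¹ • y) (toOp A ((‖y‖ : ℂ)⁻¹ • y)) ∈ numericalRange A :=
    ⟨_, by rw [norm_smul, norm_inv, Complex.norm_real, norm_norm, inv_mul_cancel₀ hy0.ne'], rfl⟩
  have h1 := mem_closedBall_zero_iff.1 (h hmem)
  rw [map_smul, inner_smul_left, inner_smul_right, norm_mul, norm_mul, RCLike.norm_conj, norm_inv,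
    Complex.norm_real, norm_norm, ← mul_assoc, ← mul_inv, inv_mul_le_iff₀ (by positivity)] at h1
  linarith

end MatrixOperator

/-! ### Unitary similarity and orthonormal bases. -/

section Columns

variable {n : ℕ} {ι : Type*} [Fintype ι]

/-- The columns of a matrix as vectors of Euclidean space. -/
noncomputable def colVec (U : Matrix (Fin n) ι ℂ) (p : ι) : EuclideanSpace ℂ (Fin n) :=
  WithLp.toLp 2 fun i => U i p

omit [Fintype ι] in
theorem inner_colVec_apply (U : Matrix (Fin n) ι ℂ) (A : Matrix (Fin n) (Fin n) ℂ) (p q : ι) :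
    inner ℂ (colVec U p) (toOp A (colVec U q)) = (Uᴴ * A * U) p q := by
  rw [Matrix.mul_assoc, Matrix.mul_apply, colVec, colVec, Matrix.toEuclideanCLM_toLp,
    EuclideanSpace.inner_toLp_toLp, dotProduct]
  refine Finset.sum_congr rfl fun i _ => ?_
  rw [mul_comm, Matrix.conjTranspose_apply, Pi.star_apply]
  rfl

omit [Fintype ι] in
theorem inner_colVec (U : Matrix (Fin n) ι ℂ) (p q : ι) :
    inner ℂ (colVec U p) (colVec U q) = (Uᴴ * U) p q := by
  have := inner_colVec_apply U 1 p q
  rwa [toOp, map_one, one_apply_eq_self, Matrix.mul_one] at this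

theorem unitarilySimilar_of_orthonormalBasis [DecidableEq ι] {A : Matrix (Fin n) (Fin n) ℂ}
    {B : Matrix ι ι ℂ} (b : OrthonormalBasis ι ℂ (EuclideanSpace ℂ (Fin n)))
    (hB : ∀ p q, B p q = inner ℂ (b p) (toOp A (b q))) : UnitarilySimilar A B := by
  have hcol : ∀ p, colVec (Matrix.of fun i p => b p i) p = b p := fun p => rfl
  have h1 : (Matrix.of fun i p => b p i)ᴴ * (Matrix.of fun i p => b p i) = (1 : Matrix ι ι ℂ) := by
    ext p q
    rw [← inner_colVec, hcol, hcol, orthonormal_iff_ite.1 b.orthonormal, Matrix.one_apply]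
  refine ⟨Matrix.of fun i p => b p i, h1, ?_, ?_⟩
  · have hcard : Fintype.card ι = Fintype.card (Fin n) := by
      rw [← Module.finrank_eq_card_basis b.toBasis, finrank_euclideanSpace]
    exact (Matrix.mul_eq_one_comm_of_equiv (Fintype.equivOfCardEq hcard)).1 h1
  · ext p q
    rw [hB, ← inner_colVec_apply, hcol, hcol]

end Columns

/-! ### The matrix pencil of a circular numerical range. -/

section Recurrence

open Polynomial

variable {n : ℕ} {A : Matrix (Fin n) (Fin n) ℂ} {r : ℝ}

/-- The quadratic matrix pencil `2 r X - X² A⋆ - A`. -/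
noncomputable def pencil (A : Matrix (Fin n) (Fin n) ℂ) (r : ℝ) : Matrix (Fin n) (Fin n) ℂ[X] :=
  (C ((2 * r : ℝ) : ℂ) * X : ℂ[X]) • 1 - (X ^ 2 : ℂ[X]) • Aᴴ.map C - A.map C

/-- For `|z| = 1` the value `r z` is attained by some `x`, which maximizes the real part of `z̄ A`.
So `z̄ A + z A⋆` has eigenvalue `2 r` at `x`; multiplying by `z` shows that `z` is a root. -/
theorem det_pencil_eq_zero (hd : numericalRange A = Metric.closedBall 0 r) (hr : 0 ≤ r) :
    (pencil A r).det = 0 := by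
  refine eq_zero_of_infinite_isRoot _ (Set.Infinite.mono (s := Metric.sphere (0 : ℂ) 1) ?_ ?_)
  · intro z hz
    have hzn : ‖z‖ = 1 := by simpa using hz
    have hzz : z * star z = 1 := by
      rw [Complex.star_def, Complex.mul_conj, Complex.normSq_eq_norm_sq, hzn]; simp
    have hmem : (r : ℂ) * z ∈ numericalRange A := by
      rw [hd, mem_closedBall_zero_iff, norm_mul, hzn, Complex.norm_real, Real.norm_of_nonneg hr,
        mul_one]
    obtain ⟨x, hx1, hx⟩ := hmem
    have hx : inner ℂ x (toOp A x) = (r : ℂ) * z := hx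
    have hmax := add_star_apply_of_isMax (S := star z • toOp A) (r := r) (x := x)
      (fun y => (Complex.re_le_norm _).trans (by
        rw [smul_apply, inner_smul_right, norm_mul, norm_star, hzn, one_mul]
        exact norm_inner_le_of_numericalRange_subset hd.subset y))
      (by
        rw [smul_apply, inner_smul_right, hx, mul_left_comm, mul_comm (star z), hzz, hx1]
        simp)
    rw [star_smul, star_star, smul_apply, smul_apply, ← toOp_star] at hmax
    have hmul : ((pencil A r).map (eval z)) = ((2 * r : ℝ) * z : ℂ) • 1 - z ^ 2 • Aᴴ - A := by
      ext i j
      simp [pencil, Matrix.one_apply, apply_ite (eval z), mul_comm (z ^ 2)]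
    change eval z (pencil A r).det = 0
    rw [← coe_evalRingHom, RingHom.map_det, RingHom.mapMatrix_apply, coe_evalRingHom, hmul,
      ← Matrix.exists_mulVec_eq_zero_iff]
    refine ⟨x.ofLp, fun h => ?_, ?_⟩
    · have : x = 0 := (WithLp.ofLp_eq_zero 2).1 h
      rw [this, norm_zero] at hx1
      exact zero_ne_one hx1
    · have h1 := congrArg WithLp.ofLp (congrArg (fun y => z • y) hmax)
      simp only [smul_add, smul_smul, hzz, one_smul, WithLp.ofLp_add, WithLp.ofLp_smul,
        Matrix.ofLp_toEuclideanCLM] at h1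
      rw [Matrix.sub_mulVec, Matrix.sub_mulVec, Matrix.smul_mulVec, Matrix.smul_mulVec,
        Matrix.one_mulVec, sub_sub, mul_comm _ z, ← h1, sq]
      abel
  · refine IsPreconnected.infinite_of_nontrivial
      (isPreconnected_sphere (by rw [Complex.rank_real_complex]; norm_num) _ _)
      ⟨1, by simp, -1, by simp, ?_⟩
    norm_num

theorem coeff_map_mulVec (B : Matrix (Fin n) (Fin n) ℂ) (w : Fin n → ℂ[X]) (i : Fin n) (j : ℕ) :
    ((B.map C *ᵥ w) i).coeff j = (B *ᵥ fun k => (w k).coeff j) i := by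
  simp [Matrix.mulVec, dotProduct, finsetSum_coeff]

/-- The singular pencil has a nonzero kernel vector with polynomial entries; comparing coefficients
gives the recurrence. -/
theorem exists_recurrence (hd : numericalRange A = Metric.closedBall 0 r) (hr : 0 ≤ r) :
    ∃ x : ℕ → EuclideanSpace ℂ (Fin n), x 0 ≠ 0 ∧ toOp A (x 0) = 0 ∧
      toOp A (x 1) = ((2 * r : ℝ) : ℂ) • x 0 ∧
      ∀ j, toOp A (x (j + 2)) = ((2 * r : ℝ) : ℂ) • x (j + 1) - (star (toOp A)) (x j) := by
  classical
  obtain ⟨w, hw0, hw⟩ := Matrix.exists_mulVec_eq_zero_iff.2 (det_pencil_eq_zero hd hr)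
  let y : ℕ → EuclideanSpace ℂ (Fin n) := fun j => WithLp.toLp 2 fun i => (w i).coeff j
  have hcoeff : ∀ i j, (C ((2 * r : ℝ) : ℂ) * (X * w i) - X ^ 2 * (Aᴴ.map C *ᵥ w) i
      - (A.map C *ᵥ w) i).coeff j = 0 := fun i j => by
    have h1 := congrFun hw i
    rw [pencil, Matrix.sub_mulVec, Matrix.sub_mulVec, Matrix.smul_mulVec, Matrix.smul_mulVec,
      Matrix.one_mulVec] at h1
    simp only [Pi.sub_apply, Pi.smul_apply, smul_eq_mul, Pi.zero_apply, mul_assoc] at h1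
    rw [h1, coeff_zero]
  have e0 : toOp A (y 0) = 0 := by
    ext i
    have h1 := hcoeff i 0
    rw [coeff_sub, coeff_sub, coeff_map_mulVec, coeff_C_mul, coeff_X_mul_zero,
      coeff_X_pow_mul'] at h1
    simpa [y] using h1
  have e1 : toOp A (y 1) = ((2 * r : ℝ) : ℂ) • y 0 := by
    ext i
    have h1 := hcoeff i 1
    rw [coeff_sub, coeff_sub, coeff_map_mulVec, coeff_C_mul, coeff_X_mul, coeff_X_pow_mul',
      if_neg (by norm_num), sub_zero, sub_eq_zero] at h1
    simpa [y] using h1.symm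
  have e2 : ∀ j, toOp A (y (j + 2)) = ((2 * r : ℝ) : ℂ) • y (j + 1) - (star (toOp A)) (y j) := by
    intro j
    rw [← toOp_star]
    ext i
    have h1 := hcoeff i (j + 2)
    rw [coeff_sub, coeff_sub, coeff_map_mulVec, coeff_C_mul, coeff_X_mul, coeff_X_pow_mul,
      coeff_map_mulVec, sub_eq_zero] at h1
    exact h1.symm
  have hex : ∃ d, y d ≠ 0 := by
    by_contra! hc
    refine hw0 (funext fun i => Polynomial.ext fun j => ?_)
    exact congrFun (congrArg WithLp.ofLp (hc j)) i
  have hd0 := Nat.find_spec hex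
  have hmin := fun m => Nat.find_min hex (m := m)
  generalize Nat.find hex = d at hd0 hmin
  have hlt : ∀ j < d, y j = 0 := fun j hj => not_not.1 (hmin j hj)
  -- Starting at the lowest nonzero coefficient makes the initial vector nonzero.
  refine ⟨fun j => y (d + j), hd0, ?_, ?_, fun j => e2 (d + j)⟩
  · rcases d with _ | _ | d
    · exact e0
    · rw [e1, hlt 0 (by omega), smul_zero]
    · rw [e2, hlt d (by omega), hlt (d + 1) (by omega), smul_zero, map_zero, sub_zero]
  · rcases d with _ | d
    · exact e1
    · change toOp A (y (d + 2)) = _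
      rw [e2, hlt d (by omega), map_zero, sub_zero]

end Recurrence

/-! ### Consequences for matrices: nilpotency, unitary parts, Jordan blocks. -/

variable {n : ℕ} {A : Matrix (Fin n) (Fin n) ℂ}

/-- If `W(A)` is a disc about the origin and `I, A, …, A ^ (a(A) - 1)` are partial isometries, then
`A` is nilpotent and the radius is `cos (π / (a(A) + 1))`. -/
theorem nilpotent_of_disc (hA : ∀ j < ascent A, IsPartialIsometry (A ^ j)) {r : ℝ} (hr : 0 ≤ r)
    (hd : numericalRange A = Metric.closedBall 0 r) :
    A ^ ascent A = 0 ∧ r = Real.cos (Real.pi / ((ascent A : ℝ) + 1)) := by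
  have hT : ∀ j < ascent A, IsPartialIsom (toOp A ^ j) := fun j hj => by
    rw [← toOp_pow]; exact (hA j hj).isPartialIsom
  obtain ⟨x, hx0, h0, h1, h2⟩ := exists_recurrence hd hr
  have hle := le_cos_of_recurrence hT (fun y hy => pow_ascent_apply_eq_zero hy) hx0 h0 h1 h2
  have hbound := norm_inner_le_of_numericalRange_subset hd.subset
  -- Ascent `0` would give `r ≤ cos π = -1`.
  have ha : 1 ≤ ascent A := by
    by_contra hc
    rw [show ascent A = 0 by omega] at hle
    norm_num at hle
    linarith
  have heq : r = Real.cos (Real.pi / ((ascent A : ℝ) + 1)) := by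
    refine le_antisymm hle ?_
    obtain ⟨m, hm⟩ := Nat.exists_eq_add_of_le' ha
    obtain ⟨y, hy1, hy2⟩ := exists_of_ascent_eq_succ hm
    have hTm := hT m (by omega)
    rw [hm, Nat.cast_add, Nat.cast_one]
    refine cos_le_of_chain (fun j hj => hT j (by omega))
      (fun w hw => inner_star_pow_mul_pow_apply_eq_zero m y hw)
      (pow_succ_star_pow_mul_pow_apply hTm hy1) (fun h => hy2 ?_)
      (fun y => (Complex.re_le_norm _).trans (hbound y))
    rw [← hTm.apply_star_apply, h, map_zero]
  refine ⟨?_, heq⟩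
  rw [← toOp_eq_zero_iff, toOp_pow]
  exact pow_eq_zero_of_numericalRadius_le ha hT (fun y hy => pow_ascent_apply_eq_zero hy)
    (heq ▸ hbound)

theorem isPartialIsometry_pow_of_nilpotent {a : ℕ} (hA : ∀ j < a, IsPartialIsometry (A ^ j))
    (h0 : A ^ a = 0) (j : ℕ) : IsPartialIsometry (A ^ j) := by
  by_cases hj : j < a
  · exact hA j hj
  · rw [pow_eq_zero_of_le (not_lt.1 hj) h0]
    exact isPartialIsometry_zero

theorem conj_pow {ι : Type*} [Fintype ι] [DecidableEq ι] {U : Matrix (Fin n) ι ℂ}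
    (h1 : Uᴴ * U = 1) (h2 : U * Uᴴ = 1) (k : ℕ) : (Uᴴ * A * U) ^ k = Uᴴ * A ^ k * U := by
  induction k with
  | zero => rw [pow_zero, pow_zero, Matrix.mul_one, h1]
  | succ k ih =>
    rw [pow_succ, ih, pow_succ]
    calc Uᴴ * A ^ k * U * (Uᴴ * A * U) = Uᴴ * A ^ k * (U * Uᴴ) * A * U := by
          simp only [Matrix.mul_assoc]
      _ = _ := by rw [h2, Matrix.mul_one]; simp only [Matrix.mul_assoc]

theorem hasNoUnitaryPart_of_pow_eq_zero {a : ℕ} (h0 : A ^ a = 0) : HasNoUnitaryPart A := by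
  rintro ⟨p, q, U, B, hp, hU, V, h1, h2, h3⟩
  have h4 := conj_pow (A := A) h1 h2 a
  rw [← h3, h0, Matrix.mul_zero, Matrix.zero_mul, Matrix.fromBlocks_diagonal_pow,
    ← Matrix.fromBlocks_zero, Matrix.fromBlocks_inj] at h4
  have h5 := (Matrix.mem_unitaryGroup_iff).1 (pow_mem hU a)
  rw [h4.1, zero_mul] at h5
  have h6 := congrFun (congrFun h5 ⟨0, hp⟩) ⟨0, hp⟩
  simp at h6

/-- In an orthonormal basis starting with the normalized `y`, both off-diagonal blocks vanish
because `y` is an eigenvector of `T` and of `T⋆`. -/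
theorem not_hasNoUnitaryPart_of_eigenvector {y : EuclideanSpace ℂ (Fin n)} {c : ℂ} (hy : y ≠ 0)
    (hc : ‖c‖ = 1) (h1 : toOp A y = c • y) (h2 : (star (toOp A)) y = star c • y) :
    ¬ HasNoUnitaryPart A := by
  have hn : n ≠ 0 := by
    rintro rfl
    exact hy (Subsingleton.elim _ _)
  have hy0 : ‖y‖ ≠ 0 := norm_ne_zero_iff.2 hy
  obtain ⟨u, hu⟩ : ∃ u, u = (‖y‖ : ℂ)⁻¹ • y := ⟨_, rfl⟩
  have hu1 : ‖u‖ = 1 := by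
    rw [hu, norm_smul, norm_inv, Complex.norm_real, norm_norm, inv_mul_cancel₀ hy0]
  have hTu : toOp A u = c • u := by rw [hu, map_smul, h1, smul_comm]
  have hTu' : (star (toOp A)) u = star c • u := by rw [hu, map_smul, h2, smul_comm]
  obtain ⟨b, hb⟩ := Orthonormal.exists_orthonormalBasis_extension_of_card_eq (𝕜 := ℂ)
    (E := EuclideanSpace ℂ (Fin n)) (ι := Fin 1 ⊕ Fin (n - 1))
    (by rw [finrank_euclideanSpace]; simp; omega)
    (v := fun _ => u) (s := {Sum.inl 0}) (by
      refine ⟨fun _ => hu1, fun i j hij => absurd (Subsingleton.elim i j) hij⟩)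
  have hb0 : b (Sum.inl 0) = u := hb _ rfl
  have horth := orthonormal_iff_ite.1 b.orthonormal
  refine fun h => h ⟨1, n - 1, Matrix.of fun _ _ => c,
    Matrix.of fun p q => inner ℂ (b (Sum.inr p)) (toOp A (b (Sum.inr q))), le_rfl, ?_,
    unitarilySimilar_of_orthonormalBasis b ?_⟩
  · rw [Matrix.mem_unitaryGroup_iff]
    ext i j
    have hcc : c * star c = 1 := by
      rw [Complex.star_def, Complex.mul_conj, Complex.normSq_eq_norm_sq, hc]; simp
    rw [Subsingleton.elim i 0, Subsingleton.elim j 0, Matrix.mul_apply]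
    simpa using hcc
  · rintro (p | p) (q | q)
    · rw [Subsingleton.elim p 0, Subsingleton.elim q 0, hb0, hTu, inner_smul_right,
        inner_self_eq_norm_sq_to_K, hu1]
      simp
    · rw [Subsingleton.elim p 0, ← inner_star_left, hb0, hTu', inner_smul_left, ← hb0, horth]
      simp
    · rw [Subsingleton.elim q 0, hb0, hTu, inner_smul_right, ← hb0, horth]
      simp
    · rfl

theorem isSumOfJordanBlocks_of_nilpotent (hA : ∀ j, IsPartialIsometry (A ^ j)) {a : ℕ}
    (h0 : A ^ a = 0) : IsSumOfJordanBlocks A := by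
  obtain ⟨s, k, b, hk, hb⟩ := exists_jordan_orthonormalBasis (T := toOp A)
    (fun j => by rw [← toOp_pow]; exact (hA j).isPartialIsom)
    ⟨a, by rw [← toOp_pow, toOp_eq_zero_iff, h0]⟩
  refine ⟨s, k, hk, unitarilySimilar_of_orthonormalBasis b ?_⟩
  rintro ⟨i, j⟩ ⟨i', j'⟩
  rw [hb, Matrix.blockDiagonal'_apply]
  by_cases h : i = i'
  · subst h
    simp [jordanBlock]
  · simp [h]

/-! ### Rotational symmetry of the numerical range. -/

section Rotation

open Metric

theorem inner_apply_rotate {V : Matrix (Fin n) (Fin n) ℂ} {z : ℂ} (h : Vᴴ * A * V = z • A)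
    (x : EuclideanSpace ℂ (Fin n)) :
    inner ℂ (toOp V x) (toOp A (toOp V x)) = z * inner ℂ x (toOp A x) := by
  have h1 := congrArg (fun B => toOp B x) h
  simp only [map_mul, map_smul] at h1
  rw [← inner_smul_right, ← smul_apply, ← h1, ← inner_star_right, ← toOp_star]
  rfl

theorem norm_apply_of_isometry {V : Matrix (Fin n) (Fin n) ℂ} (h : Vᴴ * V = 1)
    (x : EuclideanSpace ℂ (Fin n)) : ‖toOp V x‖ = ‖x‖ := by
  have h1 : inner ℂ (toOp V x) (toOp V x) = inner ℂ x x := by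
    have h2 := congrArg (fun B => toOp B x) h
    simp only [map_mul, map_one] at h2
    rw [← inner_star_right, ← toOp_star]
    exact congrArg (inner ℂ x) h2
  rw [@norm_eq_sqrt_re_inner ℂ, h1, ← @norm_eq_sqrt_re_inner ℂ]

/-- The numerical range of a matrix that is unitarily similar to all its rotations and has `0` in
its numerical range is a disc. -/
theorem isDiscAtZero_of_rotate (hn : 1 ≤ n) (h0 : (0 : ℂ) ∈ numericalRange A)
    (h : ∀ z : ℂ, ‖z‖ = 1 → ∃ V : Matrix (Fin n) (Fin n) ℂ, Vᴴ * V = 1 ∧ Vᴴ * A * V = z • A) :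
    IsDiscAtZero (numericalRange A) := by
  obtain ⟨x0, hx0, hx0'⟩ := h0
  have hx0' : inner ℂ x0 (toOp A x0) = 0 := hx0'
  have hcont : Continuous fun x : EuclideanSpace ℂ (Fin n) => ‖inner ℂ x (toOp A x)‖ := by
    fun_prop
  have hconn : IsPreconnected (sphere (0 : EuclideanSpace ℂ (Fin n)) 1) := by
    refine isPreconnected_sphere (Module.lt_rank_of_lt_finrank ?_) _ _
    rw [finrank_real_of_complex, finrank_euclideanSpace, Fintype.card_fin]
    omega
  obtain ⟨x1, hx1, hmax⟩ := (isCompact_sphere (0 : EuclideanSpace ℂ (Fin n)) 1).exists_isMaxOn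
    ⟨x0, by simpa using hx0⟩ hcont.continuousOn
  refine ⟨‖inner ℂ x1 (toOp A x1)‖, norm_nonneg _, Set.Subset.antisymm ?_ fun z hz => ?_⟩
  · rintro _ ⟨x, hx, rfl⟩
    rw [mem_closedBall_zero_iff]
    exact hmax (by simpa using hx)
  · rw [mem_closedBall_zero_iff] at hz
    -- On the connected unit sphere `|⟨A x, x⟩|` takes every value from `0` to its maximum; a
    -- rotation then adjusts the argument.
    obtain ⟨x, hx, hxz⟩ := hconn.intermediate_value (by simpa using hx0) hx1 hcont.continuousOn
      ⟨by simp [hx0'], hz⟩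
    have hx : ‖x‖ = 1 := by simpa using hx
    have hxz : ‖inner ℂ x (toOp A x)‖ = ‖z‖ := hxz
    by_cases hz0 : z = 0
    · rw [hz0, norm_zero, norm_eq_zero] at hxz
      exact ⟨x, hx, hxz.trans hz0.symm⟩
    · have hne : inner ℂ x (toOp A x) ≠ 0 := by
        rw [← norm_ne_zero_iff, hxz]; exact norm_ne_zero_iff.2 hz0
      obtain ⟨V, hV1, hV2⟩ := h (z / inner ℂ x (toOp A x)) (by
        rw [norm_div, hxz, div_self (norm_ne_zero_iff.2 hz0)])
      refine ⟨toOp V x, (norm_apply_of_isometry hV1 x).trans hx, ?_⟩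
      exact (inner_apply_rotate hV2 x).trans (div_mul_cancel₀ z hne)

theorem isDiscAtZero_of_isSumOfJordanBlocks (hn : 1 ≤ n) (h : IsSumOfJordanBlocks A) :
    IsDiscAtZero (numericalRange A) := by
  obtain ⟨s, k, -, U, h1, h2, h3⟩ := h
  have hentry : ∀ p q : Σ i, Fin (k i), (Matrix.blockDiagonal' fun i => jordanBlock (k i)) p q
      = if p.1 = q.1 ∧ (p.2 : ℕ) + 1 = q.2 then 1 else 0 := by
    rintro ⟨i, j⟩ ⟨i', j'⟩
    rw [Matrix.blockDiagonal'_apply]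
    by_cases h : i = i'
    · subst h
      simp [jordanBlock]
    · simp [h]
  generalize (Matrix.blockDiagonal' fun i => jordanBlock (k i)) = B at h3 hentry
  have hne : Nonempty (Σ i, Fin (k i)) := by
    by_contra hc
    rw [not_nonempty_iff] at hc
    have h4 := congrFun (congrFun h2 ⟨0, hn⟩) ⟨0, hn⟩
    rw [Matrix.mul_apply, Finset.univ_eq_empty, Finset.sum_empty] at h4
    simp at h4
  refine isDiscAtZero_of_rotate hn ?_ fun z hz => ?_
  · obtain ⟨p⟩ := hne
    refine ⟨colVec U p, ?_, ?_⟩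
    · rw [@norm_eq_sqrt_re_inner ℂ, inner_colVec, h1]
      simp
    · refine (inner_colVec_apply U A p p).trans ?_
      rw [← h3, hentry]
      simp
  · have hzz : star z * z = 1 := by
      rw [Complex.star_def, ← Complex.normSq_eq_conj_mul_self, Complex.normSq_eq_norm_sq, hz]
      simp
    -- Each unit entry of a block joins index `j` to `j + 1`, so conjugating by the powers of `z`
    -- multiplies it by `z`.
    let D : Matrix (Σ i, Fin (k i)) (Σ i, Fin (k i)) ℂ := Matrix.diagonal fun p => z ^ (p.2 : ℕ)
    have hDD : Dᴴ * D = 1 := by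
      rw [Matrix.diagonal_conjTranspose, Matrix.diagonal_mul_diagonal, ← Matrix.diagonal_one]
      congr 1
      funext p
      rw [Pi.star_apply, star_pow, ← mul_pow, hzz, one_pow]
    have hDBD : Dᴴ * B * D = z • B := by
      ext p q
      rw [Matrix.diagonal_conjTranspose, Matrix.mul_diagonal, Matrix.diagonal_mul, Pi.star_apply,
        Matrix.smul_apply, hentry]
      split_ifs with hpq
      · rw [← hpq.2, pow_succ, mul_one, ← mul_assoc, star_pow, ← mul_pow, hzz]
        simp
      · simp
    refine ⟨U * D * Uᴴ, ?_, ?_⟩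
    · calc (U * D * Uᴴ)ᴴ * (U * D * Uᴴ) = U * (Dᴴ * (Uᴴ * U) * D) * Uᴴ := by
            simp only [Matrix.conjTranspose_mul, Matrix.conjTranspose_conjTranspose,
              Matrix.mul_assoc]
        _ = 1 := by rw [h1, Matrix.mul_one, hDD, Matrix.mul_one, h2]
    · calc (U * D * Uᴴ)ᴴ * A * (U * D * Uᴴ) = U * (Dᴴ * (Uᴴ * A * U) * D) * Uᴴ := by
            simp only [Matrix.conjTranspose_mul, Matrix.conjTranspose_conjTranspose,
              Matrix.mul_assoc]
        _ = z • ((U * Uᴴ) * A * (U * Uᴴ)) := by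
            rw [← h3, hDBD, h3]
            simp only [Matrix.mul_smul, Matrix.smul_mul, Matrix.mul_assoc]
        _ = z • A := by rw [h2, Matrix.mul_one, Matrix.one_mul]

end Rotation

theorem pow_ascent_eq_zero_of_hasNoUnitaryPart (hU : HasNoUnitaryPart A)
    (hA : ∀ j ≤ ascent A + 1, IsPartialIsometry (A ^ j)) : A ^ ascent A = 0 := by
  by_contra hne
  rw [← toOp_eq_zero_iff, toOp_pow] at hne
  obtain ⟨y, c, hy, hc, h1, h2⟩ := exists_reducing_eigenvector
    (fun j hj => by rw [← toOp_pow]; exact (hA j hj).isPartialIsom)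
    (fun y hy => pow_ascent_apply_eq_zero hy) hne
  exact not_hasNoUnitaryPart_of_eigenvector hy hc h1 h2 hU

end PowerPartialIsometry

theorem theorem2p6 (n : ℕ) (hn : 1 ≤ n) (A : Matrix (Fin n) (Fin n) ℂ)
    (hA : (PowerPartialIsometry.ascent A : ℕ∞) ≤ PowerPartialIsometry.powerIndex A + 1) :
    List.TFAE
      [PowerPartialIsometry.IsDiscAtZero (PowerPartialIsometry.numericalRange A),
       PowerPartialIsometry.IsSumOfJordanBlocks A,
       PowerPartialIsometry.HasNoUnitaryPart A ∧
         ∀ j : ℕ, 1 ≤ j → PowerPartialIsometry.IsPartialIsometry (A ^ j),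
       PowerPartialIsometry.HasNoUnitaryPart A ∧
         ∃ l : ℕ, PowerPartialIsometry.ascent A < l ∧
           ∀ j : ℕ, 1 ≤ j → j ≤ l → PowerPartialIsometry.IsPartialIsometry (A ^ j)] ∧
    (PowerPartialIsometry.IsDiscAtZero (PowerPartialIsometry.numericalRange A) →
      PowerPartialIsometry.numericalRange A =
        {z : ℂ | ‖z‖ ≤ Real.cos (Real.pi / ((PowerPartialIsometry.ascent A : ℝ) + 1))} ∧
      PowerPartialIsometry.powerIndex A = ⊤) := by
  open PowerPartialIsometry in
  have hpow : ∀ j < ascent A, IsPartialIsometry (A ^ j) := fun j hj =>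
    isPartialIsometry_pow_of_lt_ascent hA hj
  refine ⟨?_, ?_⟩
  · tfae_have 1 → 3
    | ⟨r, hr, hd⟩ => by
      have h0 := (nilpotent_of_disc hpow hr hd).1
      exact ⟨hasNoUnitaryPart_of_pow_eq_zero h0,
        fun j _ => isPartialIsometry_pow_of_nilpotent hpow h0 j⟩
    tfae_have 3 → 4
    | ⟨hU, h⟩ => ⟨hU, ascent A + 1, Nat.lt_succ_self _, fun j hj _ => h j hj⟩
    tfae_have 4 → 2
    | ⟨hU, l, hl, h⟩ => by
      have h' : ∀ j ≤ ascent A + 1, IsPartialIsometry (A ^ j) := fun j hj => by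
        rcases j with _ | j
        · rw [pow_zero]; exact isPartialIsometry_one
        · exact h _ (by omega) (by omega)
      have h0 := pow_ascent_eq_zero_of_hasNoUnitaryPart hU h'
      exact isSumOfJordanBlocks_of_nilpotent (isPartialIsometry_pow_of_nilpotent hpow h0) h0
    tfae_have 2 → 1 := isDiscAtZero_of_isSumOfJordanBlocks hn
    tfae_finish
  · rintro ⟨r, hr, hd⟩
    obtain ⟨h0, hrc⟩ := nilpotent_of_disc hpow hr hd
    refine ⟨?_, powerIndex_eq_top (isPartialIsometry_pow_of_nilpotent hpow h0)⟩
    rw [hd, ← hrc]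
    ext z
    exact mem_closedBall_zero_iff
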